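/- **Model.** There are $N\ge 1$ products, $K\ge 1$ resources and $T\ge 1$ periods. A unit of product $i$ earns $r(i)\in[0,1]$ and consumes $a(i,k)\in\{0,1\}$ units of resource $k$; product $0$ is "no purchase", $r(0)=a(0,k)=0$. The initial stock of resource $k$ is $Tc(k)$, a positive integer. $\mathcal S$ is a family of subsets of $\{1,\dots,N\}$ with $\emptyset\in\mathcal S$ and such that every product lies in some member of $\mathcal S$; $B=\max_{S\in\mathcal S}|S|$. In each period $t$ the seller offers some $S_t\in\mathcal S$, and the customer buys $I_t\in S_t\cup\{0\}$ with multinomial logit probabilities $\varphi(i,S|v^*)=v^*(i)/(1+\sum_{\ell\in S}v^*(\ell))$ for $i\in S$ and $\varphi(0,S|v^*)=1/(1+\sum_{\ell\in S}v^*(\ell))$, where $v^*\in[1/R,R]^N$ is unknown to the seller. Put $R(S|v)=\sum_{i\in S}r(i)\varphi(i,S|v)$, $A(S,k|v)=\sum_{i\in S}a(i,k)\varphi(i,S|v)$, and let $\mathrm{Opt}(\mathrm{LP}(v))$ be the maximum of $\sum_{S\in\mathcal S}R(S|v)y(S)$ over probability vectors $y$ on $\mathcal S$ with $\sum_{S\in\mathcal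 S}A(S,k|v)y(S)\le c(k)$ for all $k$. The regret is $T\,\mathrm{Opt}(\mathrm{LP}(v^*))-\sum_{t=1}^T r(I_t)$. **Policy.** Let $0<\delta<1$ and $$\Psi=R(1+BR)^2\sqrt{6\log\tfrac{2NT(K+1)}{\delta}},\qquad \varepsilon(n)=\frac{(\sqrt N+1)\Psi}{\sqrt n},\qquad \omega=\frac{11\Psi N}{\min_kc(k)}\sqrt{\frac BT\log\frac{4(K+1)}{\delta}} .$$ The UCB policy offers in periods $t=1,\dots,N$ (as far as $t\le T$) fixed assortments $S_t\in\mathcal S$ with $t\in S_t$. In each period $t=N+1,\dots,T$ it computes a maximum likelihood estimate $v_t$, that is, a minimizer over $v\in[1/R,R]^N$ of $\sum_{s=1}^{t-1}-\log\varphi(I_s,S_s|v)$; with $n_{t-1}(i)=|\{s\le t-1:i\in S_s\}|$ it computes an optimal solution $\hat y_t$ of the linear program that maximizes $\sum_{S\in\mathcal S}\bigl(R(S|v_t)+\sum_{i\in S}\varepsilon(n_{t-1}(i))\bigr)y(S)$ over probability vectors $y$ on $\mathcal S$ with $\sum_{S\in\mathcal S}\bigl(A(S,k|v_t)-\sum_{i\in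 S}\varepsilon(n_{t-1}(i))\bigr)y(S)\le(1-\omega)c(k)$ for all $k$; and it offers $S_t$ drawn from $\hat y_t$. If at the end of such a period some resource has stock $0$, it offers $\emptyset$ in all remaining periods. **Theorem.** There is an absolute constant $C>0$ such that, for all such data with $\omega<1$, the UCB policy is well defined (the required minimizers and optimal solutions exist) and, whichever of them it computes as a function of the sales history, and whatever the warm-start assortments are, it satisfies $\sum_{t=1}^Ta(I_t,k)\le Tc(k)$ for all $k$ with probability $1$, and with probability at least $1-\delta$ its regret is at most $$C\Bigl(1+\frac1{\min_kc(k)}\Bigr)\sqrt T\,R^3B^{5/2}N\log\frac{TNK}{\delta}.$$ In particular, for $\min_k c(k)$ bounded away from $0$ the regret is $O\bigl(\sqrt T\,R^3B^{5/2}N\log\frac{TNK}{\delta}\bigr)$. -/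

import Mathlib

namespace Assortment

open scoped ENNReal

/-! ### The sales model -/

/-- The data known to the seller (except for the bound on the utilities): `N` products,
`K` resources, and a horizon of `T` periods. -/
structure Model (N K T : ℕ) where
  /-- revenue of one unit of a product -/
  r : Fin N → ℝ
  r_nonneg : ∀ i, 0 ≤ r i
  r_le_one : ∀ i, r i ≤ 1
  /-- units of a resource consumed by one unit of a product -/
  a : Fin N → Fin K → ℕ
  a_zero_or_one : ∀ i k, a i k = 0 ∨ a i k = 1
  /-- the initial stock `T * c k` of resource `k`, a positive integer -/
  cap : Fin K → ℕ
  cap_pos : ∀ k, 0 < cap k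
  /-- the family of allowed assortments -/
  family : Finset (Finset (Fin N))
  empty_mem : ∅ ∈ family

/-- An outcome of a period: a product, or `none` for "no purchase" (product 0). -/
abbrev Outcome (N : ℕ) : Type := Option (Fin N)

/-- A sales history `[(S_1, I_1), ..., (S_t, I_t)]` in chronological order. -/
abbrev History (N : ℕ) : Type := List (Finset (Fin N) × Outcome N)

/-- The MNL choice probability `φ(o, S | v)`. -/
noncomputable def choiceProb {N : ℕ} (v : Fin N → ℝ) (S : Finset (Fin N)) : Outcome N → ℝ
  | none => 1 / (1 + ∑ l ∈ S, v l)
  | some i => if i ∈ S then v i / (1 + ∑ l ∈ S, v l) else 0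

theorem choiceProb_nonneg {N : ℕ} {v : Fin N → ℝ} (hv : ∀ i, 0 < v i) (S : Finset (Fin N))
    (o : Outcome N) : 0 ≤ choiceProb v S o := by
  have h : 0 ≤ ∑ l ∈ S, v l := Finset.sum_nonneg fun l _ => (hv l).le
  cases o with
  | none => simp only [choiceProb]; positivity
  | some i =>
    simp only [choiceProb]
    split_ifs
    · exact div_nonneg (hv i).le (by positivity)
    · exact le_rfl

theorem sum_choiceProb {N : ℕ} {v : Fin N → ℝ} (hv : ∀ i, 0 < v i) (S : Finset (Fin N)) :
    ∑ o : Outcome N, choiceProb v S o = 1 := by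
  have h : 0 ≤ ∑ l ∈ S, v l := Finset.sum_nonneg fun l _ => (hv l).le
  rw [Fintype.sum_option]
  simp only [choiceProb]
  rw [Finset.sum_ite_mem, Finset.univ_inter, ← Finset.sum_div, ← add_div]
  exact div_self (by positivity)

/-- The law of the purchase of a customer with utilities `v` who is offered `S`. -/
noncomputable def choiceLaw {N : ℕ} (v : Fin N → ℝ) (hv : ∀ i, 0 < v i) (S : Finset (Fin N)) :
    PMF (Outcome N) :=
  PMF.ofFintype (fun o => ENNReal.ofReal (choiceProb v S o)) (by
    rw [← ENNReal.ofReal_sum_of_nonneg fun o _ => choiceProb_nonneg hv S o, sum_choiceProb hv S,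
      ENNReal.ofReal_one])

/-! ### Linear programs over probability vectors on the allowed assortments -/

section LP

variable {N K : ℕ}

/-- `y` is a probability vector on `F` with `∑_S A k S * y S ≤ b k` for every `k`.
The values of `y` outside `F` play no role. -/
def LPFeasible (F : Finset (Finset (Fin N))) (A : Fin K → Finset (Fin N) → ℝ) (b : Fin K → ℝ)
    (y : Finset (Fin N) → ℝ) : Prop :=
  (∀ k, ∑ S ∈ F, A k S * y S ≤ b k) ∧ ∑ S ∈ F, y S = 1 ∧ ∀ S ∈ F, 0 ≤ y S

/-- `y` maximizes `∑_S f S * y S` among the feasible points. -/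
def LPOptimal (F : Finset (Finset (Fin N))) (f : Finset (Fin N) → ℝ)
    (A : Fin K → Finset (Fin N) → ℝ) (b : Fin K → ℝ) (y : Finset (Fin N) → ℝ) : Prop :=
  LPFeasible F A b y ∧ ∀ z, LPFeasible F A b z → ∑ S ∈ F, f S * z S ≤ ∑ S ∈ F, f S * y S

/-- The law on assortments with weights `y S`, `S ∈ F`. -/
noncomputable def LPFeasible.toPMF {F : Finset (Finset (Fin N))}
    {A : Fin K → Finset (Fin N) → ℝ} {b : Fin K → ℝ} {y : Finset (Fin N) → ℝ}
    (h : LPFeasible F A b y) : PMF (Finset (Fin N)) :=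
  PMF.ofFinset (fun S => if S ∈ F then ENNReal.ofReal (y S) else 0) F
    (by
      rw [Finset.sum_congr rfl fun S hS => if_pos hS, ← ENNReal.ofReal_sum_of_nonneg h.2.2, h.2.1,
        ENNReal.ofReal_one])
    (fun _ hS => if_neg hS)

end LP

namespace Model

variable {N K T : ℕ} (M : Model N K T)

/-- The capacity `c k` per period. -/
noncomputable def c (k : Fin K) : ℝ := (M.cap k : ℝ) / T

/-- The smallest capacity per period. -/
noncomputable def cmin : ℝ := ⨅ k, M.c k

/-- The maximum size `B` of an allowed assortment. -/
def B : ℕ := M.family.sup Finset.card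

/-- Revenue of an outcome. -/
def rev : Outcome N → ℝ
  | none => 0
  | some i => M.r i

/-- Consumption of resource `k` by an outcome. -/
def use (k : Fin K) : Outcome N → ℕ
  | none => 0
  | some i => M.a i k

/-- Expected revenue `R(S | v)` of an assortment. -/
noncomputable def expRev (v : Fin N → ℝ) (S : Finset (Fin N)) : ℝ :=
  ∑ i ∈ S, M.r i * choiceProb v S (some i)

/-- Expected consumption `A(S, k | v)` of resource `k` by an assortment. -/
noncomputable def expUse (v : Fin N → ℝ) (k : Fin K) (S : Finset (Fin N)) : ℝ :=
  ∑ i ∈ S, (M.a i k : ℝ) * choiceProb v S (some i)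

/-- The optimal value of `LP(v)`; its feasible set contains the point mass at `∅`
and its objective is bounded by `1` there. -/
noncomputable def optLP (v : Fin N → ℝ) : ℝ :=
  sSup {x : ℝ | ∃ y : Finset (Fin N) → ℝ, LPFeasible M.family (M.expUse v) M.c y ∧
    x = ∑ S ∈ M.family, M.expRev v S * y S}

/-- Total revenue of a history. -/
noncomputable def totalRev (h : History N) : ℝ := (h.map fun x => M.rev x.2).sum

/-- Total consumption of resource `k` in a history. -/
def totalUse (h : History N) (k : Fin K) : ℕ := (h.map fun x => M.use k x.2).sum

/-- The stock `C(k)` that is left after a history. -/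
def stock (h : History N) (k : Fin K) : ℤ := (M.cap k : ℤ) - (M.totalUse h k : ℤ)

/-- The regret of a history of length `T` when the customers have utilities `v`. -/
noncomputable def regret (v : Fin N → ℝ) (h : History N) : ℝ := T * M.optLP v - M.totalRev h

/-! ### The parameters of the UCB policy -/

/-- The constant `Ψ`. -/
noncomputable def Psi (R δ : ℝ) : ℝ :=
  R * (1 + M.B * R) ^ 2 * Real.sqrt (6 * Real.log (2 * N * T * (K + 1) / δ))

/-- The confidence radius `ε(n)`. -/
noncomputable def eps (R δ : ℝ) (n : ℕ) : ℝ := (Real.sqrt N + 1) * M.Psi R δ / Real.sqrt n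

/-- The constant `ω`. -/
noncomputable def omega (R δ : ℝ) : ℝ :=
  11 * M.Psi R δ * N / M.cmin * Real.sqrt (M.B / T * Real.log (4 * (K + 1) / δ))

/-- Upper confidence bound on the expected revenue of `S`, given utilities `v` and counts `n`. -/
noncomputable def ucbRev (R δ : ℝ) (v : Fin N → ℝ) (n : Fin N → ℕ) (S : Finset (Fin N)) : ℝ :=
  M.expRev v S + ∑ i ∈ S, M.eps R δ (n i)

/-- Lower confidence bound on the expected consumption of resource `k` by `S`. -/
noncomputable def lcbUse (R δ : ℝ) (v : Fin N → ℝ) (n : Fin N → ℕ) (k : Fin K)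
    (S : Finset (Fin N)) : ℝ :=
  M.expUse v k S - ∑ i ∈ S, M.eps R δ (n i)

/-- `y` is an optimal solution of `UCB-LP(v, n, ω)`. -/
def IsUCBLPSolution (R δ : ℝ) (v : Fin N → ℝ) (n : Fin N → ℕ) (y : Finset (Fin N) → ℝ) : Prop :=
  LPOptimal M.family (M.ucbRev R δ v n) (M.lcbUse R δ v n)
    (fun k => (1 - M.omega R δ) * M.c k) y

/-- Abort has been signaled by the end of the history `h`: some resource was exhausted at the end
of some period `t` after the `N` periods of the warm start. -/
def Aborted (h : History N) : Prop :=
  ∃ t, N < t ∧ t ≤ h.length ∧ ∃ k, M.stock (h.take t) k = 0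

end Model

/-- The number of periods of a history in which product `i` was offered. -/
def offerCount {N : ℕ} (h : History N) (i : Fin N) : ℕ := h.countP fun x => decide (i ∈ x.1)

/-- The negative log-likelihood of the utilities `v` given a history. -/
noncomputable def negLogLik {N : ℕ} (h : History N) (v : Fin N → ℝ) : ℝ :=
  (h.map fun x => -Real.log (choiceProb v x.1 x.2)).sum

/-- `v` minimizes the negative log-likelihood of `h` over the box `[1/R, R]^N`. -/
def IsMLE {N : ℕ} (R : ℝ) (h : History N) (v : Fin N → ℝ) : Prop :=
  (∀ i, v i ∈ Set.Icc (1 / R) R) ∧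
    ∀ w : Fin N → ℝ, (∀ i, w i ∈ Set.Icc (1 / R) R) → negLogLik h v ≤ negLogLik h w

/-! ### The UCB policy -/

/-- The choices that the UCB policy leaves open: the warm-start assortments, which minimizer of the
likelihood is computed, and which optimal solution of the linear program is computed. The utilities
of the customers do not enter. -/
structure UCBPolicy {N K T : ℕ} (M : Model N K T) (R δ : ℝ) where
  warm : Fin N → Finset (Fin N)
  warm_mem : ∀ i, warm i ∈ M.family
  mem_warm : ∀ i, i ∈ warm i
  mle : History N → Fin N → ℝ
  mle_spec : ∀ h, N ≤ h.length → ¬ M.Aborted h → IsMLE R h (mle h)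
  sol : History N → Finset (Fin N) → ℝ
  sol_spec : ∀ h, N ≤ h.length → ¬ M.Aborted h →
    M.IsUCBLPSolution R δ (mle h) (offerCount h) (sol h)

namespace UCBPolicy

variable {N K T : ℕ} {M : Model N K T} {R δ : ℝ} (π : UCBPolicy M R δ)

open Classical in
/-- The law of the assortment that the policy offers in the period after the history `h`. -/
noncomputable def offerLaw (h : History N) : PMF (Finset (Fin N)) :=
  if hN : h.length < N then PMF.pure (π.warm ⟨h.length, hN⟩)
  else if hA : M.Aborted h then PMF.pure ∅
  else (π.sol_spec h (not_lt.mp hN) hA).1.toPMF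

/-- The law of the history of the first `t` periods when the policy meets customers with
utilities `v`. -/
noncomputable def historyLaw (v : Fin N → ℝ) (hv : ∀ i, 0 < v i) : ℕ → PMF (History N)
  | 0 => PMF.pure []
  | t + 1 => (historyLaw v hv t).bind fun h => (π.offerLaw h).bind fun S =>
      (choiceLaw v hv S).bind fun o => PMF.pure (h ++ [(S, o)])

/-- The probability of an event that depends on the history of all `T` periods. -/
noncomputable def prob (v : Fin N → ℝ) (hv : ∀ i, 0 < v i) (E : Set (History N)) : ℝ≥0∞ :=
  @PMF.toMeasure (History N) ⊤ (π.historyLaw v hv T) E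

end UCBPolicy

end Assortment

/-!
The regret is controlled on an event of probability at least `1 - δ`, which is described by three
kinds of martingales, and on which everything else is deterministic.

*Estimation.* In the coordinates `log v` the negative log-likelihood is convex. The Hessian of the
log-partition function of an offered set `S` is `diag p - p pᵀ`, which by Cauchy-Schwarz is at least
`p₀ diag p`, hence at least `1 / (R (1 + B R)²)` on the coordinates in `S` (`log_denominator_ge`).
The gradient at the true utilities is the negative of the `score`, a martingale whose component `i`
moves only when product `i` is offered; Hoeffding's bound, united over the products, the periods and
the number of offers, makes it at most of order `√(n(i) log)` (`prob_exists_score_le`). A minimizer of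
the likelihood is therefore within `√N Ψ / √n(i)` of the truth in coordinate `i`
(`abs_log_sub_log_le`), and since expected revenue and consumption are `1`-Lipschitz in each
coordinate `log (v i)`, the radii `ε(n(i))` are valid confidence radii (`Reach.abs_sum_sub_le`).

*Optimization.* A feasible point of the true linear program, mixed with the empty assortment with
weight `ω`, is feasible for the optimistic program. So in every period before an abort the conditional
mean revenue is at least `(1 - ω)` times the optimum minus twice the mean radius, and the conditional
mean consumption of resource `k` is at most `(1 - ω) c(k)` plus twice the mean radius
(`Reach.le_offerMean_expRev`, `Reach.offerMean_expUse_le`).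

*Accumulation.* The radii add up to at most `2 (√N + 1) Ψ √(N B T)` because `∑ 1 / √m` telescopes
against `2 √m`. Together with the Azuma-Hoeffding deviations (`prob_azuma`) and the warm start this
stays below the `slack` `ω T min_k c(k)` (`Model.budget_le_slack`), which is what the constant `11` in
`ω` pays for. Hence no stock runs out, there is no abort, and the regret is at most
`(1 + 1 / min_k c(k))` times the slack (`Reach.regret_le`). The slack has the claimed order unless
`T = N = K = 1`, where the logarithm can be close to `0` and a direct argument is used
(`UCBPolicy.prob_regret_le_of_one`).

Laws of histories are treated through expectations of exponentials of sums along a history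
(`pathSum`), for which the supermartingale property is checked one period at a time.
-/

namespace Assortment

open scoped ENNReal

/-! ### Hoeffding's lemma for finite weighted sums -/

/-- Hoeffding's lemma; the bounds on `f` are needed only where the weight is not zero. -/
theorem sum_mul_exp_le_of_mem_Icc {α : Type*} [Fintype α] {w f : α → ℝ} (hw : ∀ x, 0 ≤ w x)
    (hw1 : ∑ x, w x = 1) {l b : ℝ} (hf : ∀ x, w x ≠ 0 → f x ∈ Set.Icc l (l + b)) (s : ℝ) :
    ∑ x, w x * Real.exp (s * (f x - ∑ y, w y * f y)) ≤ Real.exp (s ^ 2 * b ^ 2 / 8) := by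
  let p : PMF α := PMF.ofFintype (fun x => ENNReal.ofReal (w x)) (by
    rw [← ENNReal.ofReal_sum_of_nonneg fun x _ => hw x, hw1, ENNReal.ofReal_one])
  have hp : ∀ x, (p x).toReal = w x := fun x => by
    simp [p, PMF.ofFintype_apply, ENNReal.toReal_ofReal (hw x)]
  let _ : MeasurableSpace α := ⊤
  have hsc : MeasurableSingletonClass α := ⟨fun _ => trivial⟩
  have hae : ∀ᵐ x ∂p.toMeasure, f x ∈ Set.Icc l (l + b) := by
    rw [MeasureTheory.ae_iff, PMF.toMeasure_apply_eq_zero_iff _ MeasurableSet.of_discrete]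
    rw [Set.disjoint_left]
    intro x hx hx'
    refine hx' (hf x fun h0 => ?_)
    rw [PMF.mem_support_iff] at hx
    apply hx
    simp [p, PMF.ofFintype_apply, h0]
  have hmean : ∫ x, f x ∂p.toMeasure = ∑ y, w y * f y := by
    rw [PMF.integral_eq_sum]
    simp [hp]
  have hsub := (ProbabilityTheory.hasSubgaussianMGF_of_mem_Icc
    (μ := p.toMeasure) (X := f) (measurable_of_finite f).aemeasurable hae).mgf_le s
  rw [hmean, ProbabilityTheory.mgf, PMF.integral_eq_sum] at hsub
  simp only [hp, smul_eq_mul] at hsub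
  refine hsub.trans (le_of_eq ?_)
  congr 1
  simp only [add_sub_cancel_left, NNReal.coe_pow, NNReal.coe_div, coe_nnnorm, Real.norm_eq_abs,
    NNReal.coe_ofNat, div_pow, sq_abs]
  ring

/-! ### Expectations with respect to a probability mass function -/

theorem tsum_bind_mul {α β : Type*} (p : PMF α) (q : α → PMF β) (f : β → ℝ≥0∞) :
    ∑' y, p.bind q y * f y = ∑' x, p x * ∑' y, q x y * f y := by
  simp_rw [PMF.bind_apply, ← ENNReal.tsum_mul_right, ← ENNReal.tsum_mul_left]
  rw [ENNReal.tsum_comm]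
  simp_rw [mul_assoc]

theorem tsum_pure_mul {α : Type*} (x : α) (f : α → ℝ≥0∞) :
    ∑' y, PMF.pure x y * f y = f x := by
  rw [tsum_eq_single x]
  · simp
  · intro y hy
    simp [PMF.pure_apply, hy]

/-- Markov's inequality in exponential form. -/
theorem toMeasure_le_ofReal_exp_neg {α : Type*} [MeasurableSpace α] [DiscreteMeasurableSpace α]
    (p : PMF α) (f : α → ℝ) (hp : ∑' x, p x * ENNReal.ofReal (Real.exp (f x)) ≤ 1) (a : ℝ) :
    p.toMeasure {x | a ≤ f x} ≤ ENNReal.ofReal (Real.exp (-a)) := by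
  rw [PMF.toMeasure_apply _ (MeasurableSet.of_discrete)]
  calc ∑' x, Set.indicator {x | a ≤ f x} p x
      ≤ ∑' x, (p x * ENNReal.ofReal (Real.exp (f x))) * ENNReal.ofReal (Real.exp (-a)) := by
        refine ENNReal.tsum_le_tsum fun x => ?_
        by_cases hx : a ≤ f x
        · rw [Set.indicator_of_mem (by exact hx), mul_assoc,
            ← ENNReal.ofReal_mul (Real.exp_pos _).le, ← Real.exp_add]
          refine le_mul_of_one_le_right (zero_le) ?_
          rw [ENNReal.one_le_ofReal]
          exact Real.one_le_exp (by linarith)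
        · rw [Set.indicator_of_notMem (by exact hx)]
          exact zero_le
    _ ≤ 1 * ENNReal.ofReal (Real.exp (-a)) := by
        rw [ENNReal.tsum_mul_right]
        gcongr
    _ = _ := one_mul _

/-! ### Sums along a history -/

/-- The sum of `g` over the periods of the history `l`, where `g` sees the history up to that period
(preceded by `pre`), the assortment offered, and the outcome. -/
def pathSumFrom {N : ℕ} (g : History N → Finset (Fin N) → Outcome N → ℝ) :
    History N → History N → ℝ
  | _, [] => 0
  | pre, x :: l => g pre x.1 x.2 + pathSumFrom g (pre ++ [x]) l

/-- The sum over the periods `t` of the history `h` of `g h_{t-1} S_t I_t`, where `h_{t-1}` is the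
history before period `t`. -/
def pathSum {N : ℕ} (g : History N → Finset (Fin N) → Outcome N → ℝ) (h : History N) : ℝ :=
  pathSumFrom g [] h

section PathSum

variable {N : ℕ} {g g' : History N → Finset (Fin N) → Outcome N → ℝ}

@[simp] theorem pathSum_nil : pathSum g [] = 0 := rfl

theorem pathSumFrom_concat (pre l : History N) (x : Finset (Fin N) × Outcome N) :
    pathSumFrom g pre (l ++ [x]) = pathSumFrom g pre l + g (pre ++ l) x.1 x.2 := by
  induction l generalizing pre with
  | nil => simp [pathSumFrom]
  | cons y l ih => simp [pathSumFrom, ih, add_assoc]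

@[simp] theorem pathSum_concat (h : History N) (x : Finset (Fin N) × Outcome N) :
    pathSum g (h ++ [x]) = pathSum g h + g h x.1 x.2 := by
  simp [pathSum, pathSumFrom_concat]

theorem pathSum_add (h : History N) :
    pathSum (fun h S o => g h S o + g' h S o) h = pathSum g h + pathSum g' h := by
  induction h using List.reverseRecOn with
  | nil => simp
  | append_singleton h x ih => simp only [pathSum_concat, ih]; ring

theorem pathSum_sub (h : History N) :
    pathSum (fun h S o => g h S o - g' h S o) h = pathSum g h - pathSum g' h := by
  induction h using List.reverseRecOn with
  | nil => simp
  | append_singleton h x ih => simp only [pathSum_concat, ih]; ring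

theorem pathSum_const_mul (c : ℝ) (h : History N) :
    pathSum (fun h S o => c * g h S o) h = c * pathSum g h := by
  induction h using List.reverseRecOn with
  | nil => simp
  | append_singleton h x ih => simp only [pathSum_concat, ih]; ring

theorem pathSum_const (c : ℝ) (h : History N) :
    pathSum (fun _ _ _ => c) h = h.length * c := by
  induction h using List.reverseRecOn with
  | nil => simp
  | append_singleton h x ih =>
    rw [pathSum_concat, ih, List.length_append, List.length_singleton]
    push_cast
    ring

theorem pathSum_eq_sum_map (f : Finset (Fin N) × Outcome N → ℝ) (h : History N) :
    pathSum (fun _ S o => f (S, o)) h = (h.map f).sum := by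
  induction h using List.reverseRecOn with
  | nil => simp
  | append_singleton h x ih => simp [pathSum_concat, ih]

/-- Comparison of sums along a history, period by period. -/
theorem pathSum_le_of_take {h : History N} (hg : ∀ t < h.length, ∀ S o,
    g (h.take t) S o ≤ g' (h.take t) S o) : pathSum g h ≤ pathSum g' h := by
  induction h using List.reverseRecOn with
  | nil => simp
  | append_singleton h x ih =>
    rw [pathSum_concat, pathSum_concat]
    refine add_le_add (ih fun t ht S o => ?_) ?_
    · have := hg t (by simp; omega) S o
      rwa [List.take_append_of_le_length ht.le] at this
    · have := hg h.length (by simp) x.1 x.2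
      rwa [List.take_append_of_le_length le_rfl, List.take_length] at this

theorem pathSum_ite_length_lt (n : ℕ) (h : History N) :
    pathSum (fun h' S o => if h'.length < n then g h' S o else 0) h = pathSum g (h.take n) := by
  induction h using List.reverseRecOn with
  | nil => simp
  | append_singleton h x ih =>
    rw [pathSum_concat, ih]
    split_ifs with hn
    · rw [List.take_of_length_le hn.le, List.take_of_length_le (by simpa using hn), pathSum_concat]
    · rw [List.take_append_of_le_length (not_lt.mp hn), add_zero]

end PathSum

/-! ### One step of the process, and exponential supermartingales -/

namespace UCBPolicy

variable {N K T : ℕ} {M : Model N K T} {R δ : ℝ} (π : UCBPolicy M R δ)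

/-- The conditional expectation, given the history `h`, of a function of the assortment offered in
the next period. -/
noncomputable def offerMean (h : History N) (f : Finset (Fin N) → ℝ) : ℝ :=
  ∑ S, (π.offerLaw h S).toReal * f S

/-- The conditional expectation, given the history `h`, of a function of the assortment offered in
the next period and of its outcome. -/
noncomputable def stepMean (v : Fin N → ℝ) (h : History N)
    (f : Finset (Fin N) → Outcome N → ℝ) : ℝ :=
  π.offerMean h fun S => ∑ o, choiceProb v S o * f S o

theorem sum_offerLaw (h : History N) : ∑ S, (π.offerLaw h S).toReal = 1 := by
  rw [← ENNReal.toReal_sum fun S _ => PMF.apply_ne_top _ S, ← tsum_fintype (L := .unconditional _),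
    PMF.tsum_coe, ENNReal.toReal_one]

theorem offerMean_const (h : History N) (c : ℝ) : π.offerMean h (fun _ => c) = c := by
  rw [offerMean, ← Finset.sum_mul, sum_offerLaw, one_mul]

theorem offerMean_mono (h : History N) {f g : Finset (Fin N) → ℝ}
    (hfg : ∀ S, π.offerLaw h S ≠ 0 → f S ≤ g S) : π.offerMean h f ≤ π.offerMean h g := by
  refine Finset.sum_le_sum fun S _ => ?_
  by_cases h0 : π.offerLaw h S = 0
  · simp [h0]
  · exact mul_le_mul_of_nonneg_left (hfg S h0) ENNReal.toReal_nonneg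

variable {v : Fin N → ℝ} (hv : ∀ i, 0 < v i)

include hv

theorem tsum_historyLaw_succ (t : ℕ) {f : History N → ℝ} (hf : ∀ h, 0 ≤ f h) :
    ∑' h, π.historyLaw v hv (t + 1) h * ENNReal.ofReal (f h) =
      ∑' h, π.historyLaw v hv t h *
        ENNReal.ofReal (π.stepMean v h fun S o => f (h ++ [(S, o)])) := by
  rw [historyLaw, tsum_bind_mul]
  refine tsum_congr fun h => ?_
  congr 1
  rw [tsum_bind_mul, stepMean, offerMean, tsum_fintype, ENNReal.ofReal_sum_of_nonneg]
  · refine Finset.sum_congr rfl fun S _ => ?_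
    rw [ENNReal.ofReal_mul ENNReal.toReal_nonneg, ENNReal.ofReal_toReal (PMF.apply_ne_top _ _),
      tsum_bind_mul, tsum_fintype, ENNReal.ofReal_sum_of_nonneg]
    · congr 1
      refine Finset.sum_congr rfl fun o _ => ?_
      rw [tsum_pure_mul, ENNReal.ofReal_mul (choiceProb_nonneg hv S o)]
      rfl
    · exact fun o _ => mul_nonneg (choiceProb_nonneg hv S o) (hf _)
  · exact fun S _ => mul_nonneg ENNReal.toReal_nonneg
      (Finset.sum_nonneg fun o _ => mul_nonneg (choiceProb_nonneg hv S o) (hf _))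

/-- If the exponential of each increment has conditional mean at most `1`, then the exponential of
the sum of the increments has mean at most `1`. -/
theorem tsum_exp_pathSum_le {g : History N → Finset (Fin N) → Outcome N → ℝ}
    (hg : ∀ h, π.stepMean v h (fun S o => Real.exp (g h S o)) ≤ 1) (t : ℕ) :
    ∑' h, π.historyLaw v hv t h * ENNReal.ofReal (Real.exp (pathSum g h)) ≤ 1 := by
  induction t with
  | zero =>
    rw [historyLaw, tsum_pure_mul]
    simp
  | succ t ih =>
    rw [tsum_historyLaw_succ π hv t fun h => (Real.exp_pos _).le]
    refine le_trans (ENNReal.tsum_le_tsum fun h => ?_) ih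
    gcongr
    simp only [pathSum_concat, Real.exp_add]
    calc π.stepMean v h (fun S o => Real.exp (pathSum g h) * Real.exp (g h S o))
        = Real.exp (pathSum g h) * π.stepMean v h (fun S o => Real.exp (g h S o)) := by
          simp only [stepMean, offerMean, Finset.mul_sum]
          refine Finset.sum_congr rfl fun S _ => Finset.sum_congr rfl fun o _ => ?_
          ring
      _ ≤ Real.exp (pathSum g h) := mul_le_of_le_one_right (Real.exp_pos _).le (hg h)

/-- An exponential tail bound for sums along a history. -/
theorem prob_le_pathSum {g : History N → Finset (Fin N) → Outcome N → ℝ}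
    (hg : ∀ h, π.stepMean v h (fun S o => Real.exp (g h S o)) ≤ 1) (a : ℝ) :
    π.prob v hv {h | a ≤ pathSum g h} ≤ ENNReal.ofReal (Real.exp (-a)) :=
  let _ : MeasurableSpace (History N) := ⊤
  toMeasure_le_ofReal_exp_neg _ _ (tsum_exp_pathSum_le π hv hg T) a

/-- The version of `prob_le_pathSum` for the history of the first `t` periods. -/
theorem prob_le_pathSum_take {g : History N → Finset (Fin N) → Outcome N → ℝ}
    (hg : ∀ h, π.stepMean v h (fun S o => Real.exp (g h S o)) ≤ 1) (t : ℕ) (a : ℝ) :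
    π.prob v hv {h | a ≤ pathSum g (h.take t)} ≤ ENNReal.ofReal (Real.exp (-a)) := by
  simp_rw [← pathSum_ite_length_lt]
  refine prob_le_pathSum π hv (fun h => ?_) a
  by_cases hlt : h.length < t
  · simpa only [if_pos hlt] using hg h
  · simp only [if_neg hlt, Real.exp_zero, mul_one, stepMean, sum_choiceProb hv]
    exact (π.offerMean_const h 1).le

theorem stepMean_const_fun (h : History N) (f : Finset (Fin N) → ℝ) :
    π.stepMean v h (fun S _ => f S) = π.offerMean h f := by
  simp only [stepMean, ← Finset.sum_mul, sum_choiceProb hv, one_mul]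

/-- The Azuma-Hoeffding inequality for the sum over all periods of the deviations of a function of
the assortment and the outcome from its conditional expectation, in the direction of the sign `σ`. -/
theorem prob_azuma {f : History N → Finset (Fin N) → Outcome N → ℝ} {b : ℝ} (hb : 0 < b)
    (hf : ∀ h S, π.offerLaw h S ≠ 0 → ∀ o, f h S o ∈ Set.Icc 0 b) {σ : ℝ} (hσ : σ = 1 ∨ σ = -1)
    {a : ℝ} (ha : 0 ≤ a) (hT : 0 < T) :
    π.prob v hv {h | h.length = T ∧ b * Real.sqrt (T * a / 2) ≤
      pathSum (fun h S o => σ * (f h S o - π.stepMean v h (f h))) h}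
      ≤ ENNReal.ofReal (Real.exp (-a)) := by
  have hσ2 : σ ^ 2 = 1 := by rcases hσ with rfl | rfl <;> norm_num
  have hT' : (0 : ℝ) < T := by exact_mod_cast hT
  -- The exponent that optimizes Chernoff's bound for `T` increments with range of length `b`.
  set s : ℝ := 4 * Real.sqrt (T * a / 2) / (T * b) with hs
  have hsq : Real.sqrt (T * a / 2) ^ 2 = T * a / 2 := Real.sq_sqrt (by positivity)
  have hstep : ∀ h, π.stepMean v h (fun S o => Real.exp
      (s * (σ * (f h S o - π.stepMean v h (f h))) - s ^ 2 * b ^ 2 / 8)) ≤ 1 := by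
    intro h
    have key := sum_mul_exp_le_of_mem_Icc
      (w := fun x : Finset (Fin N) × Outcome N =>
        (π.offerLaw h x.1).toReal * choiceProb v x.1 x.2) (f := fun x => f h x.1 x.2)
      (l := 0) (b := b)
      (fun x => mul_nonneg ENNReal.toReal_nonneg (choiceProb_nonneg hv _ _))
      (by
        rw [Fintype.sum_prod_type]
        simp only [← Finset.mul_sum, sum_choiceProb hv, mul_one, sum_offerLaw])
      (fun x hx => by
        rw [zero_add]
        refine hf h x.1 (fun h0 => hx ?_) x.2
        simp [h0]) (s * σ)
    have hm : ∑ x : Finset (Fin N) × Outcome N, (π.offerLaw h x.1).toReal * choiceProb v x.1 x.2 *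
        f h x.1 x.2 = π.stepMean v h (f h) := by
      rw [Fintype.sum_prod_type]
      simp only [stepMean, offerMean, Finset.mul_sum, mul_assoc]
    rw [hm] at key
    have e1 : π.stepMean v h (fun S o => Real.exp
        (s * (σ * (f h S o - π.stepMean v h (f h))) - s ^ 2 * b ^ 2 / 8)) =
        (∑ x : Finset (Fin N) × Outcome N, (π.offerLaw h x.1).toReal * choiceProb v x.1 x.2 *
          Real.exp (s * σ * (f h x.1 x.2 - π.stepMean v h (f h)))) *
          Real.exp (-(s ^ 2 * b ^ 2 / 8)) := by
      rw [Fintype.sum_prod_type, stepMean, offerMean, Finset.sum_mul]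
      refine Finset.sum_congr rfl fun S _ => ?_
      rw [Finset.mul_sum, Finset.sum_mul]
      refine Finset.sum_congr rfl fun o _ => ?_
      rw [sub_eq_add_neg _ (s ^ 2 * b ^ 2 / 8), Real.exp_add]
      ring_nf
    rw [e1]
    calc _ ≤ Real.exp ((s * σ) ^ 2 * b ^ 2 / 8) * Real.exp (-(s ^ 2 * b ^ 2 / 8)) := by gcongr
      _ = 1 := by rw [mul_pow, hσ2, mul_one, ← Real.exp_add, add_neg_cancel, Real.exp_zero]
  refine le_trans ?_ (prob_le_pathSum π hv hstep a)
  refine MeasureTheory.measure_mono fun h hh => ?_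
  obtain ⟨hlen, hh⟩ := hh
  rw [Set.mem_ofPred_eq, pathSum_sub (g := fun h S o => s * (σ * (f h S o - π.stepMean v h (f h))))
    (g' := fun _ _ _ => s ^ 2 * b ^ 2 / 8), pathSum_const, pathSum_const_mul (g := fun h S o =>
      σ * (f h S o - π.stepMean v h (f h))), hlen]
  have hs0 : 0 ≤ s := by positivity
  have h1 := mul_le_mul_of_nonneg_left hh hs0
  have h2 : s * (b * Real.sqrt (T * a / 2)) = 2 * a := by
    rw [hs]; field_simp; rw [hsq]; ring
  have h3 : (T : ℝ) * (s ^ 2 * b ^ 2 / 8) = a := by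
    rw [hs, div_pow, mul_pow, hsq]; field_simp; ring
  rw [h3]; linarith

end UCBPolicy

/-! ### The multinomial logit model in logarithmic coordinates -/

/-- Taylor's inequality of order two on `[0, 1]` for a function with second derivative at least
`q`. -/
theorem half_mul_le_of_deriv_deriv_ge {f f' f'' : ℝ → ℝ} {q : ℝ}
    (hf : ∀ x, HasDerivAt f (f' x) x) (hf' : ∀ x, HasDerivAt f' (f'' x) x)
    (hq : ∀ x ∈ Set.Icc (0 : ℝ) 1, q ≤ f'' x) : f 0 + f' 0 + q / 2 ≤ f 1 := by
  have h1 : MonotoneOn (fun x => f' x - q * x) (Set.Icc 0 1) := by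
    have hd : ∀ x, HasDerivAt (fun x => f' x - q * x) (f'' x - q) x := fun x => by
      simpa using (hf' x).fun_sub ((hasDerivAt_id x).const_mul q)
    refine monotoneOn_of_deriv_nonneg (convex_Icc 0 1)
      (fun x _ => (hd x).continuousAt.continuousWithinAt)
      (fun x _ => (hd x).differentiableAt.differentiableWithinAt) fun x hx => ?_
    rw [(hd x).deriv, sub_nonneg]
    exact hq x (interior_subset hx)
  have h2 : MonotoneOn (fun x => f x - f' 0 * x - q / 2 * x ^ 2) (Set.Icc 0 1) := by
    have hd : ∀ x, HasDerivAt (fun x => f x - f' 0 * x - q / 2 * x ^ 2)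
        (f' x - f' 0 - q * x) x := fun x => by
      have := ((hf x).fun_sub ((hasDerivAt_id x).const_mul (f' 0))).fun_sub
        ((hasDerivAt_pow 2 x).const_mul (q / 2))
      exact this.congr_deriv (by simp; ring)
    refine monotoneOn_of_deriv_nonneg (convex_Icc 0 1)
      (fun x _ => (hd x).continuousAt.continuousWithinAt)
      (fun x _ => (hd x).differentiableAt.differentiableWithinAt) fun x hx => ?_
    rw [(hd x).deriv]
    have hx' := interior_subset hx
    have := h1 (Set.left_mem_Icc.mpr zero_le_one) hx' hx'.1
    simp only [mul_zero, sub_zero] at this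
    linarith
  have := h2 (Set.left_mem_Icc.mpr zero_le_one) (Set.right_mem_Icc.mpr zero_le_one) zero_le_one
  norm_num at this
  linarith

section Path

variable {N : ℕ}

/-- The point at time `τ` on the path through `v` with logarithmic velocity `Δ`. -/
noncomputable def expPath (v Δ : Fin N → ℝ) (τ : ℝ) (i : Fin N) : ℝ := v i * Real.exp (τ * Δ i)

variable {v w : Fin N → ℝ} {Δ : Fin N → ℝ}

theorem expPath_zero : expPath v Δ 0 = v := by
  ext i; simp [expPath]

theorem expPath_one (hv : ∀ i, 0 < v i) (hw : ∀ i, 0 < w i) :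
    expPath v (fun i => Real.log (w i) - Real.log (v i)) 1 = w := by
  ext i
  rw [expPath, one_mul, Real.exp_sub, Real.exp_log (hw i), Real.exp_log (hv i)]
  field_simp [(hv i).ne']

theorem expPath_pos (hv : ∀ i, 0 < v i) (τ : ℝ) (i : Fin N) : 0 < expPath v Δ τ i :=
  mul_pos (hv i) (Real.exp_pos _)

theorem expPath_mem_Icc {R : ℝ} (hR : 0 < R) (hv : ∀ i, v i ∈ Set.Icc (1 / R) R)
    (hw : ∀ i, w i ∈ Set.Icc (1 / R) R) {τ : ℝ} (hτ : τ ∈ Set.Icc (0 : ℝ) 1) (i : Fin N) :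
    expPath v (fun i => Real.log (w i) - Real.log (v i)) τ i ∈ Set.Icc (1 / R) R := by
  have h0 : 0 < 1 / R := by positivity
  have hvi : 0 < v i := h0.trans_le (hv i).1
  have hwi : 0 < w i := h0.trans_le (hw i).1
  have e : expPath v (fun i => Real.log (w i) - Real.log (v i)) τ i =
      Real.exp ((1 - τ) * Real.log (v i) + τ * Real.log (w i)) := by
    rw [expPath]
    nth_rewrite 1 [← Real.exp_log hvi]
    rw [← Real.exp_add]
    ring_nf
  have l1 := Real.log_le_log h0 (hv i).1
  have l2 := Real.log_le_log h0 (hw i).1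
  have l3 := Real.log_le_log hvi (hv i).2
  have l4 := Real.log_le_log hwi (hw i).2
  obtain ⟨t0, t1⟩ := hτ
  rw [e, Set.mem_Icc, ← Real.le_log_iff_exp_le hR, ← Real.log_le_iff_le_exp h0]
  constructor <;> nlinarith

theorem hasDerivAt_expPath (v Δ : Fin N → ℝ) (τ : ℝ) (i : Fin N) :
    HasDerivAt (fun τ => expPath v Δ τ i) (expPath v Δ τ i * Δ i) τ := by
  have := (((hasDerivAt_id τ).mul_const (Δ i)).exp).const_mul (v i)
  simpa [expPath, mul_assoc] using this

theorem hasDerivAt_sum_mul_expPath (S : Finset (Fin N)) (c : Fin N → ℝ) (τ : ℝ) :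
    HasDerivAt (fun τ => ∑ i ∈ S, c i * expPath v Δ τ i)
      (∑ i ∈ S, c i * (expPath v Δ τ i * Δ i)) τ :=
  HasDerivAt.fun_sum fun i _ => (hasDerivAt_expPath v Δ τ i).const_mul (c i)

theorem hasDerivAt_denominator (S : Finset (Fin N)) (τ : ℝ) :
    HasDerivAt (fun τ => 1 + ∑ i ∈ S, expPath v Δ τ i) (∑ i ∈ S, expPath v Δ τ i * Δ i) τ := by
  simpa using (hasDerivAt_sum_mul_expPath (v := v) (Δ := Δ) S (fun _ => 1) τ).const_add 1

theorem one_le_denominator {v : Fin N → ℝ} (hv : ∀ i, 0 < v i) (S : Finset (Fin N)) :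
    1 ≤ 1 + ∑ i ∈ S, v i := by
  have : 0 ≤ ∑ i ∈ S, v i := Finset.sum_nonneg fun i _ => (hv i).le
  linarith

/-- Strong convexity of the log-partition function of the multinomial logit model in logarithmic
coordinates. The Hessian is `diag p - p pᵀ`, which is at least `p₀ diag p` by Cauchy-Schwarz. -/
theorem log_denominator_ge {R : ℝ} (hR : 0 < R) {B : ℕ} {S : Finset (Fin N)} (hS : S.card ≤ B)
    (hv : ∀ i, v i ∈ Set.Icc (1 / R) R) (hw : ∀ i, w i ∈ Set.Icc (1 / R) R) :
    Real.log (1 + ∑ i ∈ S, v i)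
      + ∑ i ∈ S, choiceProb v S (some i) * (Real.log (w i) - Real.log (v i))
      + (∑ i ∈ S, (Real.log (w i) - Real.log (v i)) ^ 2) / (R * (1 + B * R) ^ 2) / 2
      ≤ Real.log (1 + ∑ i ∈ S, w i) := by
  have h0 : 0 < 1 / R := by positivity
  have hv0 : ∀ i, 0 < v i := fun i => h0.trans_le (hv i).1
  have hw0 : ∀ i, 0 < w i := fun i => h0.trans_le (hw i).1
  set Δ : Fin N → ℝ := fun i => Real.log (w i) - Real.log (v i) with hΔ
  have hD : ∀ τ, 1 ≤ 1 + ∑ i ∈ S, expPath v Δ τ i := fun τ =>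
    one_le_denominator (expPath_pos hv0 τ) S
  have hD0 : ∀ τ, 0 < 1 + ∑ i ∈ S, expPath v Δ τ i := fun τ => zero_lt_one.trans_le (hD τ)
  have key := half_mul_le_of_deriv_deriv_ge
    (f := fun τ => Real.log (1 + ∑ i ∈ S, expPath v Δ τ i))
    (f' := fun τ => (∑ i ∈ S, expPath v Δ τ i * Δ i) / (1 + ∑ i ∈ S, expPath v Δ τ i))
    (f'' := fun τ => ((∑ i ∈ S, Δ i * (expPath v Δ τ i * Δ i)) * (1 + ∑ i ∈ S, expPath v Δ τ i) -
      (∑ i ∈ S, expPath v Δ τ i * Δ i) * (∑ i ∈ S, expPath v Δ τ i * Δ i)) /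
      (1 + ∑ i ∈ S, expPath v Δ τ i) ^ 2)
    (q := (∑ i ∈ S, (Δ i) ^ 2) / (R * (1 + B * R) ^ 2))
    (fun τ => (hasDerivAt_denominator S τ).log (hD0 τ).ne')
    (fun τ => by
      have := hasDerivAt_sum_mul_expPath (v := v) (Δ := Δ) S Δ τ
      simp only [mul_comm (Δ _) (expPath v Δ _ _)] at this
      have := this.fun_div (hasDerivAt_denominator S τ) (hD0 τ).ne'
      simpa only [mul_comm (Δ _) (expPath v Δ _ _ * Δ _), mul_comm (Δ _) (expPath v Δ _ _)]
        using this)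
    (fun τ hτ => by
      have hmem := expPath_mem_Icc hR hv hw hτ
      set u := expPath v Δ τ with hu
      have hu0 : ∀ i, 0 < u i := expPath_pos hv0 τ
      have hcs : (∑ i ∈ S, u i * Δ i) ^ 2 ≤ (∑ i ∈ S, u i) * ∑ i ∈ S, Δ i * (u i * Δ i) := by
        refine Finset.sum_sq_le_sum_mul_sum_of_sq_le_mul S (fun i _ => (hu0 i).le)
          (fun i _ => ?_) fun i _ => le_of_eq (by ring)
        have := mul_nonneg (hu0 i).le (sq_nonneg (Δ i))
        linarith [this]
      have hlow : (∑ i ∈ S, (Δ i) ^ 2) / R ≤ ∑ i ∈ S, Δ i * (u i * Δ i) := by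
        rw [Finset.sum_div]
        refine Finset.sum_le_sum fun i _ => ?_
        have := mul_le_mul_of_nonneg_right (hmem i).1 (sq_nonneg (Δ i))
        calc (Δ i) ^ 2 / R = 1 / R * (Δ i) ^ 2 := by ring
          _ ≤ u i * (Δ i) ^ 2 := this
          _ = _ := by ring
      have hup : 1 + ∑ i ∈ S, u i ≤ 1 + B * R := by
        have h1 : ∑ i ∈ S, u i ≤ S.card • R := Finset.sum_le_card_nsmul _ _ _ fun i _ => (hmem i).2
        have h2 : (S.card : ℝ) ≤ B := by exact_mod_cast hS
        rw [nsmul_eq_mul] at h1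
        nlinarith
      have hq0 : 0 ≤ (∑ i ∈ S, (Δ i) ^ 2) / R :=
        div_nonneg (Finset.sum_nonneg fun i _ => sq_nonneg _) hR.le
      rw [← div_div]
      have hDu := hD τ
      rw [← hu] at hDu
      have hDu0 : 0 < 1 + ∑ i ∈ S, u i := zero_lt_one.trans_le hDu
      refine div_le_div₀ ?_ ?_ (by positivity) (by gcongr)
      · nlinarith
      · nlinarith)
  rw [expPath_one hv0 hw0, expPath_zero] at key
  refine le_trans (le_of_eq ?_) key
  congr 2
  rw [Finset.sum_div]
  refine Finset.sum_congr rfl fun i hi => ?_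
  simp only [choiceProb, if_pos hi]
  ring

/-- In logarithmic coordinates, the expectation of a function with values in `[0, 1]` under the
multinomial logit law is Lipschitz with constant `1` in each coordinate. -/
theorem abs_sum_mul_choiceProb_sub_le (hv : ∀ i, 0 < v i) (hw : ∀ i, 0 < w i) {ρ : Fin N → ℝ}
    (hρ0 : ∀ i, 0 ≤ ρ i) (hρ1 : ∀ i, ρ i ≤ 1) (S : Finset (Fin N)) :
    |∑ i ∈ S, ρ i * choiceProb w S (some i) - ∑ i ∈ S, ρ i * choiceProb v S (some i)| ≤
      ∑ i ∈ S, |Real.log (w i) - Real.log (v i)| := by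
  set Δ : Fin N → ℝ := fun i => Real.log (w i) - Real.log (v i) with hΔ
  have hD : ∀ τ, 1 ≤ 1 + ∑ i ∈ S, expPath v Δ τ i := fun τ =>
    one_le_denominator (expPath_pos hv τ) S
  have hD0 : ∀ τ, 0 < 1 + ∑ i ∈ S, expPath v Δ τ i := fun τ => zero_lt_one.trans_le (hD τ)
  have hd := fun τ => (hasDerivAt_sum_mul_expPath (v := v) (Δ := Δ) S ρ τ).fun_div
    (hasDerivAt_denominator S τ) (hD0 τ).ne'
  have key := norm_image_sub_le_of_norm_deriv_le_segment_01' (C := ∑ i ∈ S, |Δ i|)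
    (fun τ _ => (hd τ).hasDerivWithinAt) (fun τ _ => by
      set u := expPath v Δ τ with hu
      have hu0 : ∀ i, 0 < u i := expPath_pos hv τ
      have hDu := hD τ
      rw [← hu] at hDu
      set D := 1 + ∑ i ∈ S, u i with hDdef
      have hDu0 : 0 < D := zero_lt_one.trans_le hDu
      set P := ∑ i ∈ S, ρ i * u i with hP
      have hP0 : 0 ≤ P := Finset.sum_nonneg fun i _ => mul_nonneg (hρ0 i) (hu0 i).le
      have hPD : P ≤ D := by
        have : P ≤ ∑ i ∈ S, u i :=
          Finset.sum_le_sum fun i _ => mul_le_of_le_one_left (hu0 i).le (hρ1 i)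
        linarith
      rw [Real.norm_eq_abs, abs_div, abs_of_pos (pow_pos hDu0 2), div_le_iff₀ (pow_pos hDu0 2),
        Finset.sum_mul, Finset.mul_sum, ← Finset.sum_sub_distrib, Finset.sum_mul]
      refine (Finset.abs_sum_le_sum_abs _ _).trans (Finset.sum_le_sum fun i hi => ?_)
      have e : ρ i * (u i * Δ i) * D - P * (u i * Δ i) = Δ i * (u i * (ρ i * D - P)) := by ring
      rw [e, abs_mul, abs_mul, abs_of_pos (hu0 i)]
      have huD : u i ≤ D := by
        have := Finset.single_le_sum (fun j _ => (hu0 j).le) hi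
        linarith
      have h2 : |ρ i * D - P| ≤ D := by
        rw [abs_le]
        have := mul_nonneg (hρ0 i) hDu0.le
        have := mul_le_of_le_one_left hDu0.le (hρ1 i)
        constructor <;> linarith
      rw [sq]
      gcongr)
  rw [expPath_one hv hw, expPath_zero, Real.norm_eq_abs] at key
  have e : ∀ u : Fin N → ℝ, ∑ i ∈ S, ρ i * choiceProb u S (some i) =
      (∑ i ∈ S, ρ i * u i) / (1 + ∑ i ∈ S, u i) := fun u => by
    rw [Finset.sum_div]
    refine Finset.sum_congr rfl fun i hi => ?_
    simp only [choiceProb, if_pos hi]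
    ring
  rw [e, e]
  exact key

end Path

/-! ### Consistency of the maximum likelihood estimate -/

section MLE

variable {N : ℕ}

/-- The derivative of the log-likelihood of a history with respect to `log (v i)`: the number of
sales of product `i` minus its conditional expectation. -/
noncomputable def score (v : Fin N → ℝ) (i : Fin N) (h : History N) : ℝ :=
  (h.map fun x => if i ∈ x.1 then (if x.2 = some i then 1 else 0) - choiceProb v x.1 (some i)
    else 0).sum

/-- The period `x` offers an assortment with at most `B` products and sells none or one of them. -/
def IsValidEntry (B : ℕ) (x : Finset (Fin N) × Outcome N) : Prop :=
  x.1.card ≤ B ∧ ∀ i, x.2 = some i → i ∈ x.1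

theorem offerCount_concat (h : History N) (x : Finset (Fin N) × Outcome N) (i : Fin N) :
    offerCount (h ++ [x]) i = offerCount h i + if i ∈ x.1 then 1 else 0 := by
  simp [offerCount, List.countP_append, List.countP_cons]

theorem score_concat (v : Fin N → ℝ) (h : History N) (x : Finset (Fin N) × Outcome N)
    (i : Fin N) : score v i (h ++ [x]) = score v i h +
      if i ∈ x.1 then (if x.2 = some i then 1 else 0) - choiceProb v x.1 (some i) else 0 := by
  simp [score]

theorem negLogLik_concat (v : Fin N → ℝ) (h : History N) (x : Finset (Fin N) × Outcome N) :
    negLogLik (h ++ [x]) v = negLogLik h v + -Real.log (choiceProb v x.1 x.2) := by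
  simp [negLogLik]

/-- The log-probability of an outcome is linear in `log v` up to the log-partition function. -/
theorem log_choiceProb {v : Fin N → ℝ} (hv : ∀ i, 0 < v i) {S : Finset (Fin N)} {o : Outcome N}
    (ho : ∀ i, o = some i → i ∈ S) : Real.log (choiceProb v S o) =
      (∑ i ∈ S, (if o = some i then 1 else 0) * Real.log (v i)) - Real.log (1 + ∑ i ∈ S, v i) := by
  have hD : 0 < 1 + ∑ i ∈ S, v i := zero_lt_one.trans_le (one_le_denominator hv S)
  cases o with
  | none => simp [choiceProb]
  | some j =>
    have hj := ho j rfl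
    simp only [choiceProb, if_pos hj, Real.log_div (hv j).ne' hD.ne', Option.some.injEq, ite_mul,
      one_mul, zero_mul, Finset.sum_ite_eq]

/-- Strong convexity of the negative log-likelihood in logarithmic coordinates, in which its gradient
at `v` is the negative score. Product `i` contributes in the periods in which it is offered. -/
theorem negLogLik_sub_ge {R : ℝ} (hR : 0 < R) {B : ℕ} {v w : Fin N → ℝ}
    (hv : ∀ i, v i ∈ Set.Icc (1 / R) R) (hw : ∀ i, w i ∈ Set.Icc (1 / R) R) {h : History N}
    (hh : ∀ x ∈ h, IsValidEntry B x) :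
    negLogLik h v - ∑ i, score v i h * (Real.log (w i) - Real.log (v i)) +
      (∑ i, offerCount h i * (Real.log (w i) - Real.log (v i)) ^ 2) / (R * (1 + B * R) ^ 2) / 2
      ≤ negLogLik h w := by
  have h0 : 0 < 1 / R := by positivity
  have hv0 : ∀ i, 0 < v i := fun i => h0.trans_le (hv i).1
  have hw0 : ∀ i, 0 < w i := fun i => h0.trans_le (hw i).1
  induction h using List.reverseRecOn with
  | nil => simp [negLogLik, score, offerCount]
  | append_singleton h x ih =>
    have ih := ih fun y hy => hh y (by simp [hy])
    obtain ⟨hcard, hmem⟩ := hh x (by simp)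
    have key := log_denominator_ge hR hcard hv hw
    simp only [negLogLik_concat, score_concat, offerCount_concat, log_choiceProb hv0 hmem,
      log_choiceProb hw0 hmem]
    set Δ : Fin N → ℝ := fun i => Real.log (w i) - Real.log (v i) with hΔ
    have e1 : ∑ i, (score v i h + if i ∈ x.1 then
        (if x.2 = some i then 1 else 0) - choiceProb v x.1 (some i) else 0) * Δ i =
        ∑ i, score v i h * Δ i + (∑ i ∈ x.1, (if x.2 = some i then 1 else 0) * Real.log (w i) -
          ∑ i ∈ x.1, (if x.2 = some i then 1 else 0) * Real.log (v i) -
          ∑ i ∈ x.1, choiceProb v x.1 (some i) * Δ i) := by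
      simp only [add_mul, Finset.sum_add_distrib, ite_mul, zero_mul, Finset.sum_ite_mem,
        Finset.univ_inter, ← Finset.sum_sub_distrib]
      congr 1
      refine Finset.sum_congr rfl fun i _ => ?_
      simp only [hΔ]
      split_ifs <;> ring
    have e2 : ∑ i, ((offerCount h i + if i ∈ x.1 then 1 else 0 : ℕ) : ℝ) * Δ i ^ 2 =
        ∑ i, (offerCount h i : ℝ) * Δ i ^ 2 + ∑ i ∈ x.1, Δ i ^ 2 := by
      push_cast
      simp only [add_mul, Finset.sum_add_distrib, ite_mul, zero_mul, one_mul, Finset.sum_ite_mem,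
        Finset.univ_inter]
    rw [e1, e2, add_div, add_div]
    linarith

/-- If all components of the score at the true utilities `v` are small, then the maximum likelihood
estimate is close to `v` in logarithmic coordinates. -/
theorem IsMLE.sum_offerCount_mul_sq_le {R : ℝ} (hR : 0 < R) {B : ℕ} {v w : Fin N → ℝ}
    (hv : ∀ i, v i ∈ Set.Icc (1 / R) R) {h : History N} (hw : IsMLE R h w)
    (hh : ∀ x ∈ h, IsValidEntry B x) {L : ℝ} (hL : 0 ≤ L)
    (hscore : ∀ i, |score v i h| ≤ Real.sqrt (offerCount h i * L / 2)) :
    Real.sqrt (∑ i, offerCount h i * (Real.log (w i) - Real.log (v i)) ^ 2) ≤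
      R * (1 + B * R) ^ 2 * Real.sqrt (2 * N * L) := by
  have key := negLogLik_sub_ge hR hv hw.1 hh
  have hmin := hw.2 v hv
  set Δ : Fin N → ℝ := fun i => Real.log (w i) - Real.log (v i) with hΔ
  set Q := ∑ i, (offerCount h i : ℝ) * Δ i ^ 2 with hQ
  have hQ0 : 0 ≤ Q := Finset.sum_nonneg fun i _ => by positivity
  set κ := R * (1 + B * R) ^ 2 with hκ
  have hκ0 : 0 < κ := by positivity
  have h1 : ∑ i, score v i h * Δ i ≤ Real.sqrt (L / 2) * (Real.sqrt N * Real.sqrt Q) := by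
    calc ∑ i, score v i h * Δ i
        ≤ ∑ i, Real.sqrt (L / 2) * (1 * (Real.sqrt (offerCount h i) * |Δ i|)) := by
          refine Finset.sum_le_sum fun i _ => ?_
          calc score v i h * Δ i ≤ |score v i h| * |Δ i| := by
                rw [← abs_mul]; exact le_abs_self _
            _ ≤ Real.sqrt (offerCount h i * L / 2) * |Δ i| := by gcongr; exact hscore i
            _ = _ := by
              rw [mul_div_assoc, Real.sqrt_mul (Nat.cast_nonneg _)]; ring
      _ = Real.sqrt (L / 2) * ∑ i, 1 * (Real.sqrt (offerCount h i) * |Δ i|) := by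
          rw [Finset.mul_sum]
      _ ≤ Real.sqrt (L / 2) * (Real.sqrt N * Real.sqrt Q) := by
          gcongr
          refine (Real.sum_mul_le_sqrt_mul_sqrt _ _ _).trans (le_of_eq ?_)
          congr 2
          · simp
          · refine Finset.sum_congr rfl fun i _ => ?_
            rw [mul_pow, Real.sq_sqrt (Nat.cast_nonneg _), sq_abs]
  have h2 : Q ≤ 2 * κ * (Real.sqrt (L / 2) * (Real.sqrt N * Real.sqrt Q)) := by
    have h3 : Q / κ / 2 ≤ ∑ i, score v i h * Δ i := by linarith
    have h4 := h3.trans h1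
    rw [div_div, div_le_iff₀ (by positivity)] at h4
    linarith
  rcases hQ0.eq_or_lt with h5 | h5
  · rw [← h5, Real.sqrt_zero]; positivity
  · have hsQ : 0 < Real.sqrt Q := Real.sqrt_pos.mpr h5
    have h6 : Real.sqrt Q * Real.sqrt Q ≤
        (2 * κ * (Real.sqrt (L / 2) * Real.sqrt N)) * Real.sqrt Q := by
      rw [Real.mul_self_sqrt hQ0]; linarith
    refine (le_of_mul_le_mul_right h6 hsQ).trans (le_of_eq ?_)
    have h7 : Real.sqrt (2 * N * L) = 2 * (Real.sqrt (L / 2) * Real.sqrt N) := by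
      rw [← Real.sqrt_mul (by positivity), show (2 : ℝ) * N * L = 2 ^ 2 * (L / 2 * N) by ring,
        Real.sqrt_mul (by positivity), Real.sqrt_sq (by norm_num)]
    rw [h7]; ring

/-- The error of the maximum likelihood estimate of one utility, for a product that has been
offered. -/
theorem abs_log_sub_log_le {R : ℝ} (hR : 0 < R) {B : ℕ} {v w : Fin N → ℝ}
    (hv : ∀ i, v i ∈ Set.Icc (1 / R) R) {h : History N} (hw : IsMLE R h w)
    (hh : ∀ x ∈ h, IsValidEntry B x) {L : ℝ} (hL : 0 ≤ L)
    (hscore : ∀ i, |score v i h| ≤ Real.sqrt (offerCount h i * L / 2)) {i : Fin N}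
    (hi : 0 < offerCount h i) :
    |Real.log (w i) - Real.log (v i)| ≤
      Real.sqrt N * (R * (1 + B * R) ^ 2 * Real.sqrt (2 * L)) / Real.sqrt (offerCount h i) := by
  have hi' : 0 < Real.sqrt (offerCount h i) := Real.sqrt_pos.mpr (by exact_mod_cast hi)
  rw [le_div_iff₀ hi']
  have key := hw.sum_offerCount_mul_sq_le hR hv hh hL hscore
  calc |Real.log (w i) - Real.log (v i)| * Real.sqrt (offerCount h i)
      = Real.sqrt (offerCount h i * (Real.log (w i) - Real.log (v i)) ^ 2) := by
        rw [Real.sqrt_mul (Nat.cast_nonneg _), Real.sqrt_sq_eq_abs, mul_comm]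
    _ ≤ _ := Real.sqrt_le_sqrt (Finset.single_le_sum
        (f := fun j => (offerCount h j : ℝ) * (Real.log (w j) - Real.log (v j)) ^ 2)
        (fun j _ => by positivity) (Finset.mem_univ i))
    _ ≤ _ := key
    _ = _ := by
      rw [show (2 : ℝ) * N * L = N * (2 * L) by ring, Real.sqrt_mul (Nat.cast_nonneg _)]; ring

end MLE

/-! ### The parameters of the policy -/

namespace Model

variable {N K T : ℕ} (M : Model N K T) {R δ : ℝ}

/-- The total reduction `ω T min_k c(k)` of the smallest stock that is made by the factor `1 - ω`;
it bounds all the errors that accumulate over the `T` periods. -/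
noncomputable def slack (R δ : ℝ) : ℝ :=
  11 * M.Psi R δ * N * Real.sqrt (M.B * T * Real.log (4 * (K + 1) / δ))

theorem card_le_B {S : Finset (Fin N)} (hS : S ∈ M.family) : S.card ≤ M.B :=
  Finset.le_sup (f := Finset.card) hS

theorem B_le : M.B ≤ N :=
  Finset.sup_le fun S _ => by simpa using Finset.card_le_univ S

theorem one_le_B (hN : 0 < N) (hcov : ∀ i, ∃ S ∈ M.family, i ∈ S) : 1 ≤ M.B := by
  obtain ⟨S, hS, hi⟩ := hcov ⟨0, hN⟩
  exact (Finset.card_pos.mpr ⟨_, hi⟩).trans_le (M.card_le_B hS)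

theorem mul_c (hT : 0 < T) (k : Fin K) : (T : ℝ) * M.c k = M.cap k := by
  have : (T : ℝ) ≠ 0 := by positivity
  rw [c]; field_simp

theorem c_pos (hT : 0 < T) (k : Fin K) : 0 < M.c k :=
  div_pos (by exact_mod_cast M.cap_pos k) (by exact_mod_cast hT)

theorem cmin_le (k : Fin K) : M.cmin ≤ M.c k :=
  ciInf_le (Set.finite_range _).bddBelow k

theorem cmin_pos (hK : 0 < K) (hT : 0 < T) : 0 < M.cmin := by
  have : Nonempty (Fin K) := ⟨⟨0, hK⟩⟩
  obtain ⟨k, hk⟩ := exists_eq_ciInf_of_finite (f := M.c)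
  rw [cmin, ← hk]
  exact M.c_pos hT k

theorem two_le_log (hK : 0 < K) (hδ : 0 < δ) (hδ1 : δ < 1) :
    2 ≤ Real.log (4 * (K + 1) / δ) := by
  have hK' : (1 : ℝ) ≤ K := by exact_mod_cast hK
  have h8 : (8 : ℝ) ≤ 4 * (K + 1) / δ := by
    rw [le_div_iff₀ hδ]; nlinarith
  rw [Real.le_log_iff_exp_le (by linarith)]
  refine le_trans ?_ h8
  rw [show (2 : ℝ) = 1 + 1 by norm_num, Real.exp_add]
  have := Real.exp_one_lt_d9
  have := Real.exp_pos 1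
  nlinarith

theorem four_le_arg (hN : 0 < N) (hK : 0 < K) (hT : 0 < T) (hδ : 0 < δ) (hδ1 : δ < 1) :
    4 ≤ 2 * (N : ℝ) * T * (K + 1) / δ := by
  have hN' : (1 : ℝ) ≤ N := by exact_mod_cast hN
  have hK' : (1 : ℝ) ≤ K := by exact_mod_cast hK
  have hT' : (1 : ℝ) ≤ T := by exact_mod_cast hT
  rw [le_div_iff₀ hδ]
  have : 1 ≤ (N : ℝ) * T := one_le_mul_of_one_le_of_one_le hN' hT'
  nlinarith

theorem one_le_log (hN : 0 < N) (hK : 0 < K) (hT : 0 < T) (hδ : 0 < δ) (hδ1 : δ < 1) :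
    1 ≤ Real.log (2 * (N : ℝ) * T * (K + 1) / δ) := by
  have h4 := four_le_arg hN hK hT hδ hδ1
  rw [Real.le_log_iff_exp_le (by linarith)]
  have := Real.exp_one_lt_d9
  linarith

theorem Psi_nonneg (hR : 0 ≤ R) : 0 ≤ M.Psi R δ := by
  unfold Psi; positivity

theorem eps_nonneg (hR : 0 ≤ R) (n : ℕ) : 0 ≤ M.eps R δ n := by
  have := M.Psi_nonneg (δ := δ) hR
  unfold eps; positivity

theorem eps_le_eps_one (hR : 0 ≤ R) (n : ℕ) :
    M.eps R δ n ≤ (Real.sqrt N + 1) * M.Psi R δ := by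
  have := M.Psi_nonneg (δ := δ) hR
  rcases Nat.eq_zero_or_pos n with rfl | hn
  · simp only [eps, Nat.cast_zero, Real.sqrt_zero, div_zero]; positivity
  · exact div_le_self (by positivity) (Real.one_le_sqrt.mpr (by exact_mod_cast hn))

theorem eight_le_Psi (hN : 0 < N) (hK : 0 < K) (hT : 0 < T) (hδ : 0 < δ) (hδ1 : δ < 1)
    (hR : 1 ≤ R) (hB : 1 ≤ M.B) : 8 ≤ M.Psi R δ := by
  have hl := one_le_log (K := K) hN hK hT hδ hδ1
  have hB' : (1 : ℝ) ≤ M.B := by exact_mod_cast hB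
  have h1 : 2 ≤ Real.sqrt (6 * Real.log (2 * N * T * (K + 1) / δ)) :=
    Real.le_sqrt_of_sq_le (by linarith)
  have h2 : 1 ≤ (M.B : ℝ) * R := one_le_mul_of_one_le_of_one_le hB' hR
  have h3 : 4 ≤ R * (1 + M.B * R) ^ 2 := by nlinarith
  unfold Psi
  nlinarith

theorem omega_nonneg (hK : 0 < K) (hT : 0 < T) (hR : 0 ≤ R) : 0 ≤ M.omega R δ := by
  have := M.Psi_nonneg (δ := δ) hR
  have := M.cmin_pos hK hT
  unfold omega; positivity

theorem omega_mul (hK : 0 < K) (hT : 0 < T) :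
    M.omega R δ * T * M.cmin = M.slack R δ := by
  have hc := M.cmin_pos hK hT
  have hT' : (0 : ℝ) < T := by exact_mod_cast hT
  have e : Real.sqrt (M.B * T * Real.log (4 * (K + 1) / δ)) =
      T * Real.sqrt (M.B / T * Real.log (4 * (K + 1) / δ)) := by
    rw [show (M.B : ℝ) * T * Real.log (4 * (K + 1) / δ) =
      (T : ℝ) ^ 2 * (M.B / T * Real.log (4 * (K + 1) / δ)) by field_simp,
      Real.sqrt_mul (by positivity), Real.sqrt_sq hT'.le]
  rw [slack, e, omega]
  field_simp

/-- The slack covers the warm-up periods, twice the sum of the confidence radii and its deviation,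
and the deviation of the sales. -/
theorem budget_le_slack (hN : 0 < N) (hK : 0 < K) (hT : 0 < T) (hδ : 0 < δ) (hδ1 : δ < 1)
    (hR : 1 ≤ R) (hB : 1 ≤ M.B) :
    N + 2 * (2 * ((Real.sqrt N + 1) * M.Psi R δ) * Real.sqrt (N * (M.B * T)) +
      M.B * ((Real.sqrt N + 1) * M.Psi R δ) *
        Real.sqrt (T * Real.log (4 * (K + 1) / δ) / 2)) +
      Real.sqrt (T * Real.log (4 * (K + 1) / δ) / 2) < M.slack R δ := by
  have hP := M.eight_le_Psi hN hK hT hδ hδ1 hR hB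
  have hL := two_le_log hK hδ hδ1
  rw [slack]
  set P := M.Psi R δ
  set L := Real.log (4 * (K + 1) / δ)
  have hBN : (M.B : ℝ) ≤ N := by exact_mod_cast M.B_le
  set s := Real.sqrt N
  set β := Real.sqrt M.B
  set τ := Real.sqrt T
  set q := Real.sqrt (L / 2)
  have hs : 1 ≤ s := Real.one_le_sqrt.mpr (by exact_mod_cast hN)
  have hβ : 1 ≤ β := Real.one_le_sqrt.mpr (by exact_mod_cast hB)
  have hτ : 1 ≤ τ := Real.one_le_sqrt.mpr (by exact_mod_cast hT)
  have hq : 1 ≤ q := Real.one_le_sqrt.mpr (by linarith)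
  have hβs : β ≤ s := Real.sqrt_le_sqrt hBN
  have eN : (N : ℝ) = s ^ 2 := (Real.sq_sqrt (Nat.cast_nonneg _)).symm
  have eB : (M.B : ℝ) = β ^ 2 := (Real.sq_sqrt (Nat.cast_nonneg _)).symm
  have e1 : Real.sqrt (N * (M.B * T)) = s * (β * τ) := by
    rw [Real.sqrt_mul (Nat.cast_nonneg _), Real.sqrt_mul (Nat.cast_nonneg _)]
  have e2 : Real.sqrt (T * L / 2) = τ * q := by
    rw [mul_div_assoc, Real.sqrt_mul (Nat.cast_nonneg _)]
  have e3 : Real.sqrt (M.B * T * L) = β * τ * (Real.sqrt 2 * q) := by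
    rw [show (M.B : ℝ) * T * L = (M.B * T) * (2 * (L / 2)) by ring,
      Real.sqrt_mul (by positivity), Real.sqrt_mul (Nat.cast_nonneg _),
      Real.sqrt_mul (by norm_num)]
  have h2 : 1.4 ≤ Real.sqrt 2 := Real.le_sqrt_of_sq_le (by norm_num)
  rw [e1, e2, e3, eN, eB]
  have hβ0 : 0 < β := by linarith
  have hs0 : 0 < s := by linarith
  have hτ0 : 0 < τ := by linarith
  have hq0 : 0 < q := by linarith
  have hP0 : 0 < P := by linarith
  set Y := P * s ^ 2 * β * τ * q with hY
  have hY0 : 0 < Y := by positivity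
  have t1 : s ^ 2 ≤ Y := by
    calc s ^ 2 = 1 * s ^ 2 * 1 * 1 * 1 := by ring
      _ ≤ Y := by rw [hY]; gcongr; linarith
  have t4 : τ * q ≤ Y := by
    calc τ * q = 1 * 1 ^ 2 * 1 * τ * q := by ring
      _ ≤ Y := by rw [hY]; gcongr; linarith
  have t2 : (s + 1) * P * (s * (β * τ)) ≤ 2 * Y := by
    calc (s + 1) * P * (s * (β * τ)) ≤ (s + s) * P * (s * (β * τ)) := by gcongr
      _ = 2 * (P * s ^ 2 * β * τ * 1) := by ring
      _ ≤ 2 * Y := by rw [hY]; gcongr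
  have t3 : β ^ 2 * ((s + 1) * P) * (τ * q) ≤ 2 * Y := by
    calc β ^ 2 * ((s + 1) * P) * (τ * q) = (s + 1) * P * (β * (β * (τ * q))) := by ring
      _ ≤ (s + s) * P * (s * (β * (τ * q))) := by gcongr
      _ = 2 * Y := by rw [hY]; ring
  have t5 : 15 * Y ≤ 11 * P * s ^ 2 * (β * τ * (Real.sqrt 2 * q)) := by
    calc 15 * Y ≤ 11 * Y * 1.4 := by linarith
      _ ≤ 11 * Y * Real.sqrt 2 := by gcongr
      _ = _ := by rw [hY]; ring
  linarith

theorem slack_lt_cap (hK : 0 < K) (hT : 0 < T) (hω : M.omega R δ < 1) (k : Fin K) :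
    M.slack R δ < M.cap k := by
  have hT' : (0 : ℝ) < T := by exact_mod_cast hT
  have hc := M.cmin_pos hK hT
  rw [← M.omega_mul hK hT, ← M.mul_c hT]
  have h2 := M.cmin_le k
  have h3 : 0 < (T : ℝ) * M.cmin := by positivity
  nlinarith

/-- When `ω < 1`, no stock can be exhausted during the warm start. -/
theorem N_lt_cap (hN : 0 < N) (hK : 0 < K) (hT : 0 < T) (hδ : 0 < δ) (hδ1 : δ < 1)
    (hR : 1 ≤ R) (hB : 1 ≤ M.B) (hω : M.omega R δ < 1) (k : Fin K) : N < M.cap k := by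
  have h1 := M.budget_le_slack hN hK hT hδ hδ1 hR hB
  have h2 := M.slack_lt_cap hK hT hω k
  have hP := M.Psi_nonneg (δ := δ) (zero_le_one.trans hR)
  have : (N : ℝ) < M.cap k := by
    refine lt_of_le_of_lt ?_ (h1.trans h2)
    rw [add_assoc]
    exact le_add_of_nonneg_right (by positivity)
  exact_mod_cast this

/-! ### Existence of the estimates and of the solutions of the linear programs -/

theorem exists_lpOptimal {F : Finset (Finset (Fin N))} {f : Finset (Fin N) → ℝ}
    {A : Fin K → Finset (Fin N) → ℝ} {b : Fin K → ℝ} (hne : ∃ y, LPFeasible F A b y) :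
    ∃ y, LPOptimal F f A b y := by
  -- Coordinates outside `F` play no role, so they may be taken to be `0`, which makes the set of
  -- feasible points compact.
  set P : Set (Finset (Fin N) → ℝ) := {y | LPFeasible F A b y ∧ ∀ S, S ∉ F → y S = 0} with hP
  have hcl : IsClosed P := by
    have h1 : IsClosed {y : Finset (Fin N) → ℝ | ∀ k, ∑ S ∈ F, A k S * y S ≤ b k} := by
      simp only [Set.ofPred_forall]
      exact isClosed_iInter fun k => isClosed_le (by fun_prop) continuous_const
    have h2 : IsClosed {y : Finset (Fin N) → ℝ | ∑ S ∈ F, y S = 1} :=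
      isClosed_eq (by fun_prop) continuous_const
    have h3 : IsClosed {y : Finset (Fin N) → ℝ | ∀ S ∈ F, 0 ≤ y S} := by
      simp only [Set.ofPred_forall]
      exact isClosed_iInter fun S => isClosed_iInter fun _ =>
        isClosed_le continuous_const (continuous_apply S)
    have h4 : IsClosed {y : Finset (Fin N) → ℝ | ∀ S, S ∉ F → y S = 0} := by
      simp only [Set.ofPred_forall]
      exact isClosed_iInter fun S => isClosed_iInter fun _ =>
        isClosed_eq (continuous_apply S) continuous_const
    exact (h1.inter (h2.inter h3)).inter h4
  have hsub : P ⊆ Set.univ.pi fun _ => Set.Icc (0 : ℝ) 1 := by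
    rintro y ⟨⟨-, hy1, hy0⟩, hyF⟩ S -
    by_cases hS : S ∈ F
    · exact ⟨hy0 S hS, hy1 ▸ Finset.single_le_sum hy0 hS⟩
    · rw [hyF S hS]; simp
  have hcomp : IsCompact P :=
    (isCompact_univ_pi fun _ => isCompact_Icc).of_isClosed_subset hcl hsub
  have hrestr : ∀ z, LPFeasible F A b z →
      (fun S => if S ∈ F then z S else 0) ∈ P := by
    rintro z ⟨hz1, hz2, hz3⟩
    refine ⟨⟨fun k => ?_, ?_, fun S hS => ?_⟩, fun S hS => if_neg hS⟩
    · exact (Finset.sum_congr rfl fun S hS => by simp only [if_pos hS]).trans_le (hz1 k)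
    · exact (Finset.sum_congr rfl fun S hS => if_pos hS).trans hz2
    · simpa only [if_pos hS] using hz3 S hS
  obtain ⟨z, hz⟩ := hne
  obtain ⟨y, hy, hmax⟩ := hcomp.exists_isMaxOn ⟨_, hrestr z hz⟩
    (f := fun y => ∑ S ∈ F, f S * y S) (by fun_prop)
  refine ⟨y, hy.1, fun z hz => ?_⟩
  have := hmax (hrestr z hz)
  simp only [Set.mem_ofPred_eq] at this
  rwa [Finset.sum_congr rfl fun S hS => by rw [if_pos hS]] at this

theorem continuousOn_negLogLik {R : ℝ} (hR : 0 < R) (h : History N) :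
    ContinuousOn (negLogLik h) (Set.univ.pi fun _ => Set.Icc (1 / R) R) := by
  have hpos : ∀ v ∈ Set.univ.pi fun _ : Fin N => Set.Icc (1 / R) R, ∀ i, 0 < v i :=
    fun v hv i => (one_div_pos.mpr hR).trans_le (hv i trivial).1
  induction h using List.reverseRecOn with
  | nil =>
    have e : negLogLik (N := N) [] = fun _ => 0 := funext fun v => by simp [negLogLik]
    rw [e]
    exact continuousOn_const
  | append_singleton h x ih =>
    rw [show negLogLik (h ++ [x]) = fun v => negLogLik h v + -Real.log (choiceProb v x.1 x.2) from
      funext fun v => negLogLik_concat v h x]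
    refine ih.add (ContinuousOn.neg ?_)
    obtain ⟨S, o⟩ := x
    have hD : ∀ v ∈ Set.univ.pi fun _ : Fin N => Set.Icc (1 / R) R, 1 + ∑ i ∈ S, v i ≠ 0 :=
      fun v hv => (zero_lt_one.trans_le (one_le_denominator (hpos v hv) S)).ne'
    have hDc : ContinuousOn (fun v : Fin N → ℝ => 1 + ∑ i ∈ S, v i)
      (Set.univ.pi fun _ => Set.Icc (1 / R) R) := by fun_prop
    cases o with
    | none =>
      simp only [choiceProb]
      exact (continuousOn_const.div hDc hD).log fun v hv => div_ne_zero one_ne_zero (hD v hv)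
    | some i =>
      by_cases hi : i ∈ S
      · simp only [choiceProb, if_pos hi]
        exact ((continuous_apply i).continuousOn.div hDc hD).log fun v hv =>
          div_ne_zero (hpos v hv i).ne' (hD v hv)
      · simp only [choiceProb, if_neg hi]
        exact continuousOn_const

theorem exists_isMLE {R : ℝ} (hR : 1 ≤ R) (h : History N) : ∃ v, IsMLE R h v := by
  have hR0 : 0 < R := zero_lt_one.trans_le hR
  have hne : (Set.univ.pi fun _ : Fin N => Set.Icc (1 / R) R).Nonempty :=
    ⟨fun _ => 1, fun _ _ => ⟨(div_le_one hR0).mpr hR, hR⟩⟩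
  obtain ⟨v, hv, hmin⟩ := (isCompact_univ_pi fun _ => isCompact_Icc).exists_isMinOn hne
    (continuousOn_negLogLik hR0 h)
  exact ⟨v, fun i => hv i trivial, fun w hw => hmin fun i _ => hw i⟩

/-- The point mass at the empty assortment is feasible because `ω < 1`. -/
theorem exists_isUCBLPSolution (hT : 0 < T) (hω : M.omega R δ < 1) (v : Fin N → ℝ)
    (n : Fin N → ℕ) : ∃ y, M.IsUCBLPSolution R δ v n y := by
  refine exists_lpOptimal ⟨fun S => if S = ∅ then 1 else 0, fun k => ?_, ?_, fun S _ => ?_⟩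
  · simp only [mul_ite, mul_one, mul_zero, Finset.sum_ite_eq', if_pos M.empty_mem]
    simp only [lcbUse, expUse, Finset.sum_empty, sub_zero]
    exact mul_nonneg (by linarith) (M.c_pos hT k).le
  · rw [Finset.sum_ite_eq', if_pos M.empty_mem]
  · dsimp only; split_ifs <;> norm_num

theorem nonempty_ucbPolicy (hT : 0 < T) (hR : 1 ≤ R) (hω : M.omega R δ < 1)
    (hcov : ∀ i, ∃ S ∈ M.family, i ∈ S) : Nonempty (UCBPolicy M R δ) := by
  choose warm hwarm hmem using hcov
  choose mle hmle using fun h : History N => exists_isMLE (N := N) hR h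
  choose sol hsol using fun h : History N =>
    M.exists_isUCBLPSolution hT hω (mle h) (offerCount h)
  exact ⟨⟨warm, hwarm, hmem, mle, fun h _ _ => hmle h, sol, fun h _ _ => hsol h⟩⟩

end Model

/-! ### Histories that occur with positive probability -/

namespace UCBPolicy

variable {N K T : ℕ} {M : Model N K T} {R δ : ℝ} (π : UCBPolicy M R δ)

/-- The history can be produced by the policy: every assortment in it has positive probability given
the history before it, and every sale is of an offered product. -/
inductive Reach : History N → Prop
  | nil : Reach []
  | snoc {h : History N} {S : Finset (Fin N)} {o : Outcome N} (hh : Reach h)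
      (hS : π.offerLaw h S ≠ 0) (ho : ∀ i, o = some i → i ∈ S) : Reach (h ++ [(S, o)])

variable {π}

theorem reach_of_historyLaw_ne_zero {v : Fin N → ℝ} (hv : ∀ i, 0 < v i) {t : ℕ} {h : History N}
    (hh : π.historyLaw v hv t h ≠ 0) : π.Reach h ∧ h.length = t := by
  induction t generalizing h with
  | zero =>
    rw [historyLaw, ← PMF.mem_support_iff, PMF.support_pure, Set.mem_singleton_iff] at hh
    subst hh
    exact ⟨.nil, rfl⟩
  | succ t ih =>
    rw [historyLaw, ← PMF.mem_support_iff, PMF.mem_support_bind_iff] at hh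
    obtain ⟨h', hh', hh⟩ := hh
    rw [PMF.mem_support_bind_iff] at hh
    obtain ⟨S, hS, hh⟩ := hh
    rw [PMF.mem_support_bind_iff] at hh
    obtain ⟨o, ho, hh⟩ := hh
    rw [PMF.support_pure, Set.mem_singleton_iff] at hh
    subst hh
    rw [PMF.mem_support_iff] at hh' hS ho
    obtain ⟨h1, h2⟩ := ih hh'
    refine ⟨.snoc h1 hS fun i hi => ?_, by simp [h2]⟩
    by_contra hiS
    apply ho
    subst hi
    simp [choiceLaw, PMF.ofFintype_apply, choiceProb, hiS]

theorem Reach.take {h : History N} (hh : π.Reach h) (t : ℕ) : π.Reach (h.take t) := by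
  induction hh with
  | nil => simpa using Reach.nil
  | @snoc h S o hh hS ho ih =>
    by_cases ht : t ≤ h.length
    · rwa [List.take_append_of_le_length ht]
    · rw [List.take_of_length_le (by simp; omega)]
      exact .snoc hh hS ho

theorem offerLaw_of_lt {h : History N} (hN : h.length < N) :
    π.offerLaw h = PMF.pure (π.warm ⟨h.length, hN⟩) := dif_pos hN

theorem offerLaw_of_aborted {h : History N} (hN : N ≤ h.length) (hA : M.Aborted h) :
    π.offerLaw h = PMF.pure ∅ := by
  rw [offerLaw, dif_neg (not_lt.mpr hN), dif_pos hA]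

theorem offerLaw_of_not_aborted {h : History N} (hN : N ≤ h.length) (hA : ¬ M.Aborted h) :
    π.offerLaw h = (π.sol_spec h hN hA).1.toPMF := by
  rw [offerLaw, dif_neg (not_lt.mpr hN), dif_neg hA]

theorem mem_family_of_offerLaw_ne_zero {h : History N} {S : Finset (Fin N)}
    (hS : π.offerLaw h S ≠ 0) : S ∈ M.family := by
  rw [← PMF.mem_support_iff] at hS
  by_cases hN : h.length < N
  · rw [offerLaw_of_lt hN, PMF.support_pure, Set.mem_singleton_iff] at hS
    exact hS ▸ π.warm_mem _
  by_cases hA : M.Aborted h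
  · rw [offerLaw_of_aborted (not_lt.mp hN) hA, PMF.support_pure, Set.mem_singleton_iff] at hS
    exact hS ▸ M.empty_mem
  · rw [offerLaw_of_not_aborted (not_lt.mp hN) hA, PMF.mem_support_iff] at hS
    by_contra hSF
    exact hS (by simp [LPFeasible.toPMF, PMF.ofFinset_apply, hSF])

theorem Reach.isValidEntry {h : History N} (hh : π.Reach h) :
    ∀ x ∈ h, IsValidEntry M.B x := by
  induction hh with
  | nil => simp
  | snoc hh hS ho ih =>
    intro x hx
    rw [List.mem_append, List.mem_singleton] at hx
    rcases hx with hx | rfl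
    · exact ih x hx
    · exact ⟨M.card_le_B (mem_family_of_offerLaw_ne_zero hS), ho⟩

theorem Reach.offerCount_pos {h : History N} (hh : π.Reach h) (i : Fin N)
    (hi : (i : ℕ) < h.length) : 0 < offerCount h i := by
  induction hh with
  | nil => simp at hi
  | @snoc h S o hh hS ho ih =>
    rw [offerCount_concat]
    rcases Nat.lt_or_ge i h.length with hlt | hge
    · exact Nat.add_pos_left (ih hlt) _
    · rw [List.length_append, List.length_singleton] at hi
      have hei : (i : ℕ) = h.length := by omega
      have hN : h.length < N := hei ▸ i.isLt
      rw [offerLaw_of_lt hN, ← PMF.mem_support_iff, PMF.support_pure,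
        Set.mem_singleton_iff] at hS
      have hiS : i ∈ S := by
        have := π.mem_warm i
        rw [hS]
        convert this
        exact hei.symm
      simp [hiS]

end UCBPolicy

namespace Model

variable {N K T : ℕ} (M : Model N K T)

theorem use_le_one (k : Fin K) (o : Outcome N) : M.use k o ≤ 1 := by
  cases o with
  | none => simp [use]
  | some i => rcases M.a_zero_or_one i k with h | h <;> simp [use, h]

theorem totalUse_concat (h : History N) (x : Finset (Fin N) × Outcome N) (k : Fin K) :
    M.totalUse (h ++ [x]) k = M.totalUse h k + M.use k x.2 := by
  simp [totalUse]

theorem totalUse_le_length (h : History N) (k : Fin K) : M.totalUse h k ≤ h.length := by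
  induction h using List.reverseRecOn with
  | nil => simp [totalUse]
  | append_singleton h x ih =>
    rw [totalUse_concat, List.length_append, List.length_singleton]
    exact add_le_add ih (M.use_le_one k x.2)

theorem totalUse_take_le (h : History N) (t : ℕ) (k : Fin K) :
    M.totalUse (h.take t) k ≤ M.totalUse h k := by
  conv_rhs => rw [← List.take_append_drop t h]
  rw [totalUse, totalUse, List.map_append, List.sum_append]
  exact Nat.le_add_right _ _

end Model

namespace UCBPolicy

variable {N K T : ℕ} {M : Model N K T} {R δ : ℝ} {π : UCBPolicy M R δ}

/-- A stock that survives the warm start is never overdrawn: it falls by at most one unit per period,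
and once it is `0` only the empty assortment is offered. -/
theorem Reach.totalUse_le_cap {h : History N} (hh : π.Reach h) {k : Fin K} (hk : N < M.cap k) :
    M.totalUse h k ≤ M.cap k := by
  induction hh with
  | nil => simp [Model.totalUse]
  | @snoc h S o hh hS ho ih =>
    rw [M.totalUse_concat]
    have h1 := M.use_le_one k o
    have h2 := M.totalUse_le_length h k
    dsimp only
    rcases Nat.lt_or_ge N h.length with hlt | hge
    · by_cases hA : M.Aborted h
      · rw [offerLaw_of_aborted hlt.le hA, ← PMF.mem_support_iff, PMF.support_pure,
          Set.mem_singleton_iff] at hS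
        subst hS
        cases o with
        | none => simpa [Model.use] using ih
        | some i => simpa using ho i rfl
      · have : M.totalUse h k ≠ M.cap k := fun he =>
          hA ⟨h.length, hlt, le_rfl, k, by rw [List.take_length, Model.stock, he, sub_self]⟩
        omega
    · omega

theorem prob_eq_one_of_forall {v : Fin N → ℝ} (hv : ∀ i, 0 < v i) {E : Set (History N)}
    (hE : ∀ h, π.Reach h → h.length = T → h ∈ E) : π.prob v hv E = 1 := by
  let _ : MeasurableSpace (History N) := ⊤
  rw [prob, PMF.toMeasure_apply_eq_one_iff _ MeasurableSet.of_discrete]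
  intro h hh
  obtain ⟨h1, h2⟩ := reach_of_historyLaw_ne_zero hv hh
  exact hE h h1 h2

end UCBPolicy

/-! ### Concentration of the score -/

theorem offerCount_le_length {N : ℕ} (h : History N) (i : Fin N) : offerCount h i ≤ h.length :=
  List.countP_le_length

theorem score_eq_zero {N : ℕ} {v : Fin N → ℝ} {i : Fin N} {h : History N}
    (hi : offerCount h i = 0) : score v i h = 0 := by
  induction h using List.reverseRecOn with
  | nil => simp [score]
  | append_singleton h x ih =>
    rw [offerCount_concat, Nat.add_eq_zero_iff] at hi
    have hx : i ∉ x.1 := fun hx => by simp [hx] at hi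
    rw [score_concat, ih hi.1, if_neg hx, add_zero]

namespace UCBPolicy

variable {N K T : ℕ} {M : Model N K T} {R δ : ℝ} (π : UCBPolicy M R δ) {v : Fin N → ℝ}
  (hv : ∀ i, 0 < v i)

include hv

/-- Hoeffding's bound for the score of one product at one time and for one value of the random number
of offers, with the deviation scaled to that number. -/
theorem prob_score_le (i : Fin N) {σ : ℝ} (hσ : σ ^ 2 = 1) (t : ℕ) {m : ℕ} (hm : 1 ≤ m) {a : ℝ}
    (ha : 0 ≤ a) :
    π.prob v hv {h | offerCount (h.take t) i = m ∧
      Real.sqrt (m * a / 2) ≤ σ * score v i (h.take t)} ≤ ENNReal.ofReal (Real.exp (-a)) := by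
  have hm' : (0 : ℝ) < m := by exact_mod_cast hm
  -- The optimal exponent for a sum of `m` variables with range of length `1`.
  set s : ℝ := 4 * Real.sqrt (m * a / 2) / m with hs
  have hsq : Real.sqrt (m * a / 2) ^ 2 = m * a / 2 := Real.sq_sqrt (by positivity)
  set g : History N → Finset (Fin N) → Outcome N → ℝ := fun _ S o => if i ∈ S then
    s * σ * ((if o = some i then 1 else 0) - choiceProb v S (some i)) - s ^ 2 / 8 else 0 with hg
  have hstep : ∀ h, π.stepMean v h (fun S o => Real.exp (g h S o)) ≤ 1 := by
    intro h
    rw [← π.offerMean_const h 1]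
    refine π.offerMean_mono h fun S _ => ?_
    by_cases hi : i ∈ S
    · have key := sum_mul_exp_le_of_mem_Icc (w := choiceProb v S)
        (f := fun o => if o = some i then 1 else 0) (choiceProb_nonneg hv S) (sum_choiceProb hv S)
        (l := 0) (b := 1) (fun o _ => by split_ifs <;> simp) (s * σ)
      simp only [mul_ite, mul_one, mul_zero, Finset.sum_ite_eq', Finset.mem_univ, if_true,
        one_pow, mul_pow, hσ] at key
      calc ∑ o, choiceProb v S o * Real.exp (g h S o)
          = (∑ o, choiceProb v S o * Real.exp (s * σ *
              ((if o = some i then 1 else 0) - choiceProb v S (some i)))) *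
              Real.exp (-(s ^ 2 / 8)) := by
            rw [Finset.sum_mul]
            refine Finset.sum_congr rfl fun o _ => ?_
            simp only [hg, if_pos hi]
            rw [sub_eq_add_neg _ (s ^ 2 / 8), Real.exp_add, ← mul_assoc]
        _ ≤ Real.exp (s ^ 2 / 8) * Real.exp (-(s ^ 2 / 8)) := by gcongr
        _ = 1 := by rw [← Real.exp_add, add_neg_cancel, Real.exp_zero]
    · simp only [hg, if_neg hi, Real.exp_zero, mul_one, sum_choiceProb hv, le_refl]
  have hpath : ∀ h, pathSum g h = s * (σ * score v i h) - s ^ 2 / 8 * offerCount h i := by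
    intro h
    induction h using List.reverseRecOn with
    | nil => simp [score, offerCount]
    | append_singleton h x ih =>
      rw [pathSum_concat, ih, score_concat, offerCount_concat]
      simp only [hg]
      split_ifs <;> push_cast <;> ring
  refine le_trans ?_ (π.prob_le_pathSum_take hv hstep t a)
  refine MeasureTheory.measure_mono fun h hh => ?_
  obtain ⟨hcount, hh⟩ := hh
  rw [Set.mem_ofPred_eq, hpath, hcount]
  have h1 := mul_le_mul_of_nonneg_left hh (show 0 ≤ s by positivity)
  have h2 : s * Real.sqrt (m * a / 2) = 2 * a := by
    rw [hs, div_mul_eq_mul_div, mul_assoc, ← sq, hsq]; field_simp; ring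
  have h3 : s ^ 2 / 8 * m = a := by
    rw [hs, div_pow, mul_pow, hsq]; field_simp; ring
  linarith

/-- With high probability, all components of the score are small before every period. The union
bound runs over the products, the periods, the number of offers of the product, and the sign. -/
theorem prob_exists_score_le {a : ℝ} (ha : 0 ≤ a) :
    π.prob v hv {h | ∃ i, ∃ t < T, Real.sqrt (offerCount (h.take t) i * a / 2) <
      |score v i (h.take t)|} ≤ ENNReal.ofReal (2 * N * T * T * Real.exp (-a)) := by
  let _ : MeasurableSpace (History N) := ⊤
  set I : Finset (Fin N × ℕ × ℕ × Bool) :=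
    Finset.univ ×ˢ Finset.range T ×ˢ Finset.Icc 1 T ×ˢ Finset.univ with hI
  let sgn : Bool → ℝ := fun b => if b then 1 else -1
  have hsub : {h : History N | ∃ i, ∃ t < T, Real.sqrt (offerCount (h.take t) i * a / 2) <
      |score v i (h.take t)|} ⊆ ⋃ x ∈ I, {h | offerCount (h.take x.2.1) x.1 = x.2.2.1 ∧
      Real.sqrt (x.2.2.1 * a / 2) ≤ sgn x.2.2.2 * score v x.1 (h.take x.2.1)} := by
    rintro h ⟨i, t, ht, hit⟩
    simp only [Set.mem_iUnion]
    have hpos : 1 ≤ offerCount (h.take t) i := by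
      by_contra h0
      rw [score_eq_zero (by omega), abs_zero] at hit
      exact absurd hit (not_lt.mpr (Real.sqrt_nonneg _))
    have hle : offerCount (h.take t) i ≤ T :=
      (offerCount_le_length _ i).trans ((List.length_take_le t h).trans ht.le)
    rcases lt_abs.mp hit with hs | hs
    · exact ⟨(i, t, offerCount (h.take t) i, true), by simp [hI, ht, hpos, hle], rfl, by simpa [sgn] using hs.le⟩
    · exact ⟨(i, t, offerCount (h.take t) i, false), by simp [hI, ht, hpos, hle], rfl, by simpa [sgn] using hs.le⟩
  refine (MeasureTheory.measure_mono hsub).trans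
    ((MeasureTheory.measure_biUnion_finset_le _ _).trans ?_)
  calc _ ≤ ∑ x ∈ I, ENNReal.ofReal (Real.exp (-a)) := by
        refine Finset.sum_le_sum fun x hx => ?_
        refine π.prob_score_le hv x.1 (σ := sgn x.2.2.2) ?_ x.2.1 ?_ ha
        · cases x.2.2.2 <;> simp [sgn]
        · simp only [hI, Finset.mem_product, Finset.mem_Icc] at hx
          exact hx.2.2.1.1
    _ = ENNReal.ofReal (2 * N * T * T * Real.exp (-a)) := by
        rw [Finset.sum_const, ← ENNReal.ofReal_nsmul]
        congr 1
        simp [hI]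
        ring

end UCBPolicy

/-! ### Confidence bounds and one step of the policy -/

namespace Model

variable {N K T : ℕ} (M : Model N K T) {R δ : ℝ}

theorem sum_choiceProb_mul_rev (v : Fin N → ℝ) (S : Finset (Fin N)) :
    ∑ o, choiceProb v S o * M.rev o = M.expRev v S := by
  rw [Fintype.sum_option]
  simp only [rev, mul_zero, zero_add, choiceProb, ite_mul, zero_mul, Finset.sum_ite_mem,
    Finset.univ_inter, expRev]
  refine Finset.sum_congr rfl fun i hi => ?_
  rw [if_pos hi, mul_comm]

theorem sum_choiceProb_mul_use (v : Fin N → ℝ) (k : Fin K) (S : Finset (Fin N)) :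
    ∑ o, choiceProb v S o * (M.use k o : ℝ) = M.expUse v k S := by
  rw [Fintype.sum_option]
  simp only [use, Nat.cast_zero, mul_zero, zero_add, choiceProb, ite_mul, zero_mul,
    Finset.sum_ite_mem, Finset.univ_inter, expUse]
  refine Finset.sum_congr rfl fun i hi => ?_
  rw [if_pos hi, mul_comm]

theorem rev_mem_Icc (o : Outcome N) : M.rev o ∈ Set.Icc (0 : ℝ) 1 := by
  cases o with
  | none => simp [rev]
  | some i => exact ⟨M.r_nonneg i, M.r_le_one i⟩

theorem use_mem_Icc (k : Fin K) (o : Outcome N) : (M.use k o : ℝ) ∈ Set.Icc (0 : ℝ) 1 :=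
  ⟨Nat.cast_nonneg _, by exact_mod_cast M.use_le_one k o⟩

variable {v : Fin N → ℝ} (hv : ∀ i, 0 < v i)

include hv

theorem expRev_nonneg (S : Finset (Fin N)) : 0 ≤ M.expRev v S :=
  Finset.sum_nonneg fun i _ => mul_nonneg (M.r_nonneg i) (choiceProb_nonneg hv S _)

theorem expRev_le_one (S : Finset (Fin N)) : M.expRev v S ≤ 1 := by
  rw [← sum_choiceProb_mul_rev, ← sum_choiceProb hv S]
  exact Finset.sum_le_sum fun o _ =>
    mul_le_of_le_one_right (choiceProb_nonneg hv S o) (M.rev_mem_Icc o).2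

theorem expUse_le_one (k : Fin K) (S : Finset (Fin N)) : M.expUse v k S ≤ 1 := by
  rw [← sum_choiceProb_mul_use, ← sum_choiceProb hv S]
  exact Finset.sum_le_sum fun o _ =>
    mul_le_of_le_one_right (choiceProb_nonneg hv S o) (M.use_mem_Icc k o).2

omit hv in
theorem optLP_le {u : ℝ} (hT : 0 < T) (hu : ∀ y, LPFeasible M.family (M.expUse v) M.c y →
    ∑ S ∈ M.family, M.expRev v S * y S ≤ u) : M.optLP v ≤ u := by
  refine csSup_le ?_ ?_
  · refine ⟨_, fun S => if S = ∅ then 1 else 0, ⟨fun k => ?_, ?_, fun S _ => ?_⟩, rfl⟩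
    · simp only [mul_ite, mul_one, mul_zero, Finset.sum_ite_eq', if_pos M.empty_mem]
      simpa only [expUse, Finset.sum_empty] using (M.c_pos hT k).le
    · rw [Finset.sum_ite_eq', if_pos M.empty_mem]
    · dsimp only; split_ifs <;> norm_num
  · rintro x ⟨y, hy, rfl⟩
    exact hu y hy

theorem optLP_le_one (hT : 0 < T) : M.optLP v ≤ 1 := by
  refine M.optLP_le hT fun y hy => ?_
  rw [← hy.2.1]
  exact Finset.sum_le_sum fun S hS => mul_le_of_le_one_left (hy.2.2 S hS) (M.expRev_le_one hv S)

end Model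

namespace UCBPolicy

variable {N K T : ℕ} {M : Model N K T} {R δ : ℝ} (π : UCBPolicy M R δ) {v : Fin N → ℝ}

theorem offerMean_of_not_aborted {h : History N} (hN : N ≤ h.length) (hA : ¬ M.Aborted h)
    (f : Finset (Fin N) → ℝ) :
    π.offerMean h f = ∑ S ∈ M.family, f S * π.sol h S := by
  rw [offerMean, offerLaw_of_not_aborted hN hA]
  have hpos := (π.sol_spec h hN hA).1.2.2
  rw [← Finset.sum_subset (Finset.subset_univ M.family)]
  · refine Finset.sum_congr rfl fun S hS => ?_
    rw [LPFeasible.toPMF, PMF.ofFinset_apply, if_pos hS, ENNReal.toReal_ofReal (hpos S hS),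
      mul_comm]
  · intro S _ hS
    rw [LPFeasible.toPMF, PMF.ofFinset_apply, if_neg hS, ENNReal.toReal_zero, zero_mul]

/-- The total confidence radius of an assortment after the history `h`. -/
noncomputable def epsSum (M : Model N K T) (R δ : ℝ) (h : History N) (S : Finset (Fin N)) : ℝ :=
  ∑ i ∈ S, M.eps R δ (offerCount h i)

theorem epsSum_nonneg (hR : 0 ≤ R) (h : History N) (S : Finset (Fin N)) :
    0 ≤ epsSum M R δ h S :=
  Finset.sum_nonneg fun _ _ => M.eps_nonneg hR _

theorem epsSum_le (hR : 0 ≤ R) (h : History N) {S : Finset (Fin N)} (hS : S ∈ M.family) :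
    epsSum M R δ h S ≤ M.B * ((Real.sqrt N + 1) * M.Psi R δ) := by
  have hP := M.Psi_nonneg (δ := δ) hR
  refine (Finset.sum_le_card_nsmul S _ _ fun i _ => M.eps_le_eps_one hR _).trans ?_
  rw [nsmul_eq_mul]
  gcongr
  exact M.card_le_B hS

theorem offerMean_epsSum_nonneg (hR : 0 ≤ R) (h : History N) :
    0 ≤ π.offerMean h (epsSum M R δ h) := by
  rw [← π.offerMean_const h 0]
  exact π.offerMean_mono h fun S _ => epsSum_nonneg hR h S

/-- The confidence radii of a product that is offered `n` times add up to a multiple of the sum of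
`1 / √m` over `0 < m < n`, which is at most `2 √(n - 1)`. The first offer contributes nothing, since
the radius `ε(0)` is `0` by the convention for division by zero; accordingly `n - 1` is the truncated
difference of natural numbers. -/
theorem pathSum_epsSum_le (hR : 0 ≤ R) (h : History N) :
    pathSum (fun h S _ => epsSum M R δ h S) h ≤
      2 * ((Real.sqrt N + 1) * M.Psi R δ) *
        ∑ i, Real.sqrt ((offerCount h i - 1 : ℕ) : ℝ) := by
  have hP := M.Psi_nonneg (δ := δ) hR
  induction h using List.reverseRecOn with
  | nil => simp [offerCount]
  | append_singleton h x ih =>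
    rw [pathSum_concat]
    have hstep : epsSum M R δ h x.1 ≤ 2 * ((Real.sqrt N + 1) * M.Psi R δ) *
        ∑ i ∈ x.1, (Real.sqrt (offerCount h i) - Real.sqrt ((offerCount h i - 1 : ℕ) : ℝ)) := by
      rw [epsSum, Finset.mul_sum]
      refine Finset.sum_le_sum fun i _ => ?_
      rw [Model.eps]
      generalize offerCount h i = n
      rcases Nat.eq_zero_or_pos n with rfl | hn
      · simp
      · have hn0 : 0 < Real.sqrt n := Real.sqrt_pos.mpr (by exact_mod_cast hn)
        rw [div_le_iff₀ hn0]
        have e1 : Real.sqrt n * Real.sqrt n = n := Real.mul_self_sqrt (Nat.cast_nonneg _)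
        have e2 : Real.sqrt ((n - 1 : ℕ) : ℝ) * Real.sqrt ((n - 1 : ℕ) : ℝ) = n - 1 := by
          rw [Real.mul_self_sqrt (Nat.cast_nonneg _), Nat.cast_sub hn, Nat.cast_one]
        have h1 : 1 ≤ 2 * (Real.sqrt n - Real.sqrt ((n - 1 : ℕ) : ℝ)) * Real.sqrt n := by
          nlinarith [sq_nonneg (Real.sqrt n - Real.sqrt ((n - 1 : ℕ) : ℝ))]
        have h2 : 0 ≤ (Real.sqrt N + 1) * M.Psi R δ := by positivity
        calc (Real.sqrt N + 1) * M.Psi R δ = (Real.sqrt N + 1) * M.Psi R δ * 1 := by ring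
          _ ≤ (Real.sqrt N + 1) * M.Psi R δ *
              (2 * (Real.sqrt n - Real.sqrt ((n - 1 : ℕ) : ℝ)) * Real.sqrt n) := by gcongr
          _ = _ := by ring
    have e : ∑ i, Real.sqrt ((offerCount (h ++ [x]) i - 1 : ℕ) : ℝ) =
        ∑ i, Real.sqrt ((offerCount h i - 1 : ℕ) : ℝ) +
        ∑ i ∈ x.1, (Real.sqrt (offerCount h i) - Real.sqrt ((offerCount h i - 1 : ℕ) : ℝ)) := by
      rw [← Finset.univ_inter x.1, ← Finset.sum_ite_mem, ← Finset.sum_add_distrib]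
      refine Finset.sum_congr rfl fun i _ => ?_
      rw [offerCount_concat]
      split_ifs <;> simp
    rw [e, mul_add]
    exact add_le_add ih hstep

variable {π}

theorem Reach.sum_offerCount_le {h : History N} (hh : π.Reach h) :
    ∑ i, offerCount h i ≤ h.length * M.B := by
  induction hh with
  | nil => simp [offerCount]
  | @snoc h S o hh hS ho ih =>
    simp only [offerCount_concat, Finset.sum_add_distrib, Finset.sum_ite_mem, Finset.univ_inter,
      Finset.sum_const, smul_eq_mul, mul_one, List.length_append, List.length_singleton, add_mul,
      one_mul]
    exact add_le_add ih (M.card_le_B (mem_family_of_offerLaw_ne_zero hS))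

theorem Reach.pathSum_epsSum_le {h : History N} (hR : 0 ≤ R) (hh : π.Reach h)
    (hlen : h.length = T) :
    pathSum (fun h S _ => epsSum M R δ h S) h ≤
      2 * ((Real.sqrt N + 1) * M.Psi R δ) * Real.sqrt (N * (M.B * T)) := by
  have hP := M.Psi_nonneg (δ := δ) hR
  refine (UCBPolicy.pathSum_epsSum_le hR h).trans ?_
  gcongr
  calc ∑ i, Real.sqrt ((offerCount h i - 1 : ℕ) : ℝ)
      ≤ ∑ i, 1 * Real.sqrt (offerCount h i) := by
        refine Finset.sum_le_sum fun i _ => ?_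
        rw [one_mul]
        exact Real.sqrt_le_sqrt (by exact_mod_cast Nat.sub_le _ _)
    _ ≤ _ := Real.sum_mul_le_sqrt_mul_sqrt _ _ _
    _ = Real.sqrt N * Real.sqrt (∑ i, offerCount h i : ℕ) := by
        congr 2
        · simp
        · push_cast
          exact Finset.sum_congr rfl fun i _ => Real.sq_sqrt (Nat.cast_nonneg _)
    _ ≤ Real.sqrt N * Real.sqrt (M.B * T) := by
        gcongr
        have := hh.sum_offerCount_le
        rw [hlen, mul_comm] at this
        exact_mod_cast this
    _ = _ := (Real.sqrt_mul (Nat.cast_nonneg _) _).symm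

/-- The confidence bound: if the score is small, then expectations under the estimated utilities are
within the total confidence radius of those under the true utilities. -/
theorem Reach.abs_sum_sub_le (hR : 1 ≤ R) (hv : ∀ i, v i ∈ Set.Icc (1 / R) R)
    (hN : 0 < N) (hK : 0 < K) (hT : 0 < T) (hδ : 0 < δ) (hδ1 : δ < 1)
    {h : History N} (hh : π.Reach h) (hNh : N ≤ h.length) (hA : ¬ M.Aborted h)
    (hscore : ∀ i, |score v i h| ≤
      Real.sqrt (offerCount h i * (3 * Real.log (2 * N * T * (K + 1) / δ)) / 2))
    {ρ : Fin N → ℝ} (hρ0 : ∀ i, 0 ≤ ρ i) (hρ1 : ∀ i, ρ i ≤ 1) (S : Finset (Fin N)) :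
    |∑ i ∈ S, ρ i * choiceProb (π.mle h) S (some i) - ∑ i ∈ S, ρ i * choiceProb v S (some i)| ≤
      epsSum M R δ h S := by
  have hR0 : 0 < R := zero_lt_one.trans_le hR
  have h0 : 0 < 1 / R := by positivity
  have hmle := π.mle_spec h hNh hA
  have hlog := Model.one_le_log hN hK hT hδ hδ1
  refine (abs_sum_mul_choiceProb_sub_le (fun i => h0.trans_le (hv i).1)
    (fun i => h0.trans_le (hmle.1 i).1) hρ0 hρ1 S).trans (Finset.sum_le_sum fun i _ => ?_)
  refine (abs_log_sub_log_le hR0 hv hmle hh.isValidEntry (by positivity) hscore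
    (hh.offerCount_pos i (i.isLt.trans_le hNh))).trans ?_
  have hP := M.Psi_nonneg (δ := δ) hR0.le
  have e : R * (1 + M.B * R) ^ 2 * Real.sqrt (2 * (3 * Real.log (2 * N * T * (K + 1) / δ))) =
      M.Psi R δ := by
    rw [Model.Psi, ← mul_assoc 2 3]; norm_num
  rw [e, Model.eps]
  gcongr
  linarith

section Step

variable (hR : 1 ≤ R) (hv : ∀ i, v i ∈ Set.Icc (1 / R) R)
  (hN : 0 < N) (hK : 0 < K) (hT : 0 < T) (hδ : 0 < δ) (hδ1 : δ < 1) (hω : M.omega R δ < 1)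
  {h : History N} (hh : π.Reach h)
  (hscore : ∀ i, |score v i h| ≤
      Real.sqrt (offerCount h i * (3 * Real.log (2 * N * T * (K + 1) / δ)) / 2))

include hR hv hN hK hT hδ hδ1 hω hh hscore

/-- The conditional mean consumption in one period. The feasibility of the computed solution for the
reduced program bounds its consumption up to two confidence radii. -/
theorem Reach.offerMean_expUse_le (k : Fin K) :
    π.offerMean h (M.expUse v k) ≤ (if h.length < N then 1 else 0) +
      (1 - M.omega R δ) * M.c k + 2 * π.offerMean h (epsSum M R δ h) := by
  have hR0 : 0 < R := zero_lt_one.trans_le hR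
  have h0 : 0 < 1 / R := by positivity
  have hv0 : ∀ i, 0 < v i := fun i => h0.trans_le (hv i).1
  have he := π.offerMean_epsSum_nonneg hR0.le h
  have hc := mul_nonneg (sub_nonneg.mpr hω.le) (M.c_pos hT k).le
  by_cases hNh : h.length < N
  · rw [if_pos hNh]
    have : π.offerMean h (M.expUse v k) ≤ 1 := by
      rw [← π.offerMean_const h 1]
      exact π.offerMean_mono h fun S _ => M.expUse_le_one hv0 k S
    linarith
  rw [if_neg hNh]
  rw [not_lt] at hNh
  by_cases hA : M.Aborted h
  · have : π.offerMean h (M.expUse v k) ≤ 0 := by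
      rw [← π.offerMean_const h 0]
      refine π.offerMean_mono h fun S hS => ?_
      rw [offerLaw_of_aborted hNh hA, ← PMF.mem_support_iff, PMF.support_pure,
        Set.mem_singleton_iff] at hS
      subst hS
      simp [Model.expUse]
    linarith
  rw [π.offerMean_of_not_aborted hNh hA, π.offerMean_of_not_aborted hNh hA]
  have hfeas := (π.sol_spec h hNh hA).1
  have hk := hfeas.1 k
  suffices hs : ∑ S ∈ M.family, M.expUse v k S * π.sol h S ≤
      ∑ S ∈ M.family, M.lcbUse R δ (π.mle h) (offerCount h) k S * π.sol h S +
        2 * ∑ S ∈ M.family, epsSum M R δ h S * π.sol h S by linarith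
  rw [Finset.mul_sum, ← Finset.sum_add_distrib]
  refine Finset.sum_le_sum fun S hS => ?_
  have hy := hfeas.2.2 S hS
  have hconf := abs_le.mp (hh.abs_sum_sub_le hR hv hN hK hT hδ hδ1 hNh hA hscore
    (ρ := fun i => (M.a i k : ℝ)) (fun i => Nat.cast_nonneg _)
    (fun i => (M.use_mem_Icc k (some i)).2) S)
  have hle : M.expUse v k S ≤ M.lcbUse R δ (π.mle h) (offerCount h) k S +
      2 * epsSum M R δ h S := by
    have h1 : M.expUse v k S ≤ M.expUse (π.mle h) k S + epsSum M R δ h S := by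
      unfold Model.expUse; linarith
    have h2 : M.lcbUse R δ (π.mle h) (offerCount h) k S =
      M.expUse (π.mle h) k S - epsSum M R δ h S := rfl
    linarith
  calc M.expUse v k S * π.sol h S ≤ _ := mul_le_mul_of_nonneg_right hle hy
    _ = _ := by ring

/-- The conditional mean revenue in one period. Optimism: the reduced program with confidence bounds
has at least `1 - ω` times the optimal value of the true program. -/
theorem Reach.le_offerMean_expRev (hA : ¬ M.Aborted h) :
    (1 - M.omega R δ) * M.optLP v - (if h.length < N then 1 else 0) -
      2 * π.offerMean h (epsSum M R δ h) ≤ π.offerMean h (M.expRev v) := by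
  have hR0 : 0 < R := zero_lt_one.trans_le hR
  have h0 : 0 < 1 / R := by positivity
  have hv0 : ∀ i, 0 < v i := fun i => h0.trans_le (hv i).1
  have he := π.offerMean_epsSum_nonneg hR0.le h
  have hω0 := M.omega_nonneg (δ := δ) hK hT hR0.le
  have hω1 : 0 < 1 - M.omega R δ := sub_pos.mpr hω
  by_cases hNh : h.length < N
  · rw [if_pos hNh]
    have h1 : 0 ≤ π.offerMean h (M.expRev v) := by
      rw [← π.offerMean_const h 0]
      exact π.offerMean_mono h fun S _ => M.expRev_nonneg hv0 S
    have h2 := M.optLP_le_one hv0 hT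
    nlinarith
  rw [if_neg hNh]
  rw [not_lt] at hNh
  rw [π.offerMean_of_not_aborted hNh hA, π.offerMean_of_not_aborted hNh hA]
  have hsol := π.sol_spec h hNh hA
  have hconfR := fun S => abs_le.mp (hh.abs_sum_sub_le hR hv hN hK hT hδ hδ1 hNh hA hscore
    (ρ := M.r) M.r_nonneg M.r_le_one S)
  have hconfA := fun k S => abs_le.mp (hh.abs_sum_sub_le hR hv hN hK hT hδ hδ1 hNh hA hscore
    (ρ := fun i => (M.a i k : ℝ)) (fun i => Nat.cast_nonneg _)
    (fun i => (M.use_mem_Icc k (some i)).2) S)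
  have hucb : ∀ S, M.ucbRev R δ (π.mle h) (offerCount h) S =
      M.expRev (π.mle h) S + epsSum M R δ h S := fun S => rfl
  have hlcb : ∀ k S, M.lcbUse R δ (π.mle h) (offerCount h) k S =
      M.expUse (π.mle h) k S - epsSum M R δ h S := fun k S => rfl
  have hge : ∀ S, M.expRev v S ≤ M.ucbRev R δ (π.mle h) (offerCount h) S := fun S => by
    have := (hconfR S).1
    rw [hucb]; unfold Model.expRev; linarith
  have hle : ∀ S, M.ucbRev R δ (π.mle h) (offerCount h) S ≤
      M.expRev v S + 2 * epsSum M R δ h S := fun S => by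
    have := (hconfR S).2
    rw [hucb]; unfold Model.expRev; linarith
  have hleA : ∀ k S, M.lcbUse R δ (π.mle h) (offerCount h) k S ≤ M.expUse v k S := fun k S => by
    have := (hconfA k S).2
    rw [hlcb]; unfold Model.expUse; linarith
  have hopt : M.optLP v ≤ (∑ S ∈ M.family, M.ucbRev R δ (π.mle h) (offerCount h) S *
      π.sol h S) / (1 - M.omega R δ) := by
    refine M.optLP_le hT fun y hy => ?_
    rw [le_div_iff₀ hω1]
    -- Mixing a feasible point with the empty assortment makes it feasible for the reduced program.
    have hz : LPFeasible M.family (M.lcbUse R δ (π.mle h) (offerCount h))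
        (fun k => (1 - M.omega R δ) * M.c k)
        (fun S => (1 - M.omega R δ) * y S + M.omega R δ * if S = ∅ then 1 else 0) := by
      refine ⟨fun k => ?_, ?_, fun S hS => ?_⟩
      · calc ∑ S ∈ M.family, M.lcbUse R δ (π.mle h) (offerCount h) k S *
              ((1 - M.omega R δ) * y S + M.omega R δ * if S = ∅ then 1 else 0)
            ≤ ∑ S ∈ M.family, (1 - M.omega R δ) * (M.expUse v k S * y S) := by
              refine Finset.sum_le_sum fun S hS => ?_
              have hy' := hy.2.2 S hS
              by_cases hS0 : S = ∅
              · subst hS0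
                simp [Model.lcbUse, Model.expUse]
              · rw [if_neg hS0, mul_zero, add_zero]
                have := mul_le_mul_of_nonneg_right (hleA k S) (mul_nonneg hω1.le hy')
                linarith
          _ ≤ (1 - M.omega R δ) * M.c k := by
              rw [← Finset.mul_sum]
              exact mul_le_mul_of_nonneg_left (hy.1 k) hω1.le
      · rw [Finset.sum_add_distrib, ← Finset.mul_sum, ← Finset.mul_sum, hy.2.1,
          Finset.sum_ite_eq', if_pos M.empty_mem]
        ring
      · have hy' := hy.2.2 S hS
        dsimp only
        split_ifs <;> positivity
    refine le_trans ?_ (hsol.2 _ hz)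
    rw [Finset.sum_mul]
    refine Finset.sum_le_sum fun S hS => ?_
    have hy' := hy.2.2 S hS
    by_cases hS0 : S = ∅
    · subst hS0
      simp [Model.ucbRev, Model.expRev]
    · rw [if_neg hS0, mul_zero, add_zero]
      have := mul_le_mul_of_nonneg_right (hge S) (mul_nonneg hω1.le hy')
      linarith
  rw [le_div_iff₀ hω1] at hopt
  have hsum : ∑ S ∈ M.family, M.ucbRev R δ (π.mle h) (offerCount h) S * π.sol h S ≤
      ∑ S ∈ M.family, M.expRev v S * π.sol h S +
        2 * ∑ S ∈ M.family, epsSum M R δ h S * π.sol h S := by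
    rw [Finset.mul_sum, ← Finset.sum_add_distrib]
    refine Finset.sum_le_sum fun S hS => ?_
    calc _ ≤ _ := mul_le_mul_of_nonneg_right (hle S) (hsol.1.2.2 S hS)
      _ = _ := by ring
  linarith

end Step

end UCBPolicy

/-! ### The regret on the good event -/

namespace Model

variable {N K T : ℕ} (M : Model N K T) {R δ : ℝ}

theorem totalRev_eq_pathSum (h : History N) :
    M.totalRev h = pathSum (fun _ _ o => M.rev o) h :=
  (pathSum_eq_sum_map (fun x => M.rev x.2) h).symm

theorem totalUse_eq_pathSum (h : History N) (k : Fin K) :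
    (M.totalUse h k : ℝ) = pathSum (fun _ _ o => (M.use k o : ℝ)) h := by
  rw [pathSum_eq_sum_map (fun x => (M.use k x.2 : ℝ)), totalUse, Nat.cast_list_sum, List.map_map]
  rfl

theorem not_aborted_take {h : History N} (hh : ∀ k, M.totalUse h k < M.cap k) (t : ℕ) :
    ¬ M.Aborted (h.take t) := by
  rintro ⟨s, -, -, k, hk⟩
  have h1 := M.totalUse_take_le (h.take t) s k
  have h2 := M.totalUse_take_le h t k
  have h3 := hh k
  rw [stock, sub_eq_zero] at hk
  omega

end Model

namespace UCBPolicy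

variable {N K T : ℕ} {M : Model N K T} {R δ : ℝ} {π : UCBPolicy M R δ} {v : Fin N → ℝ}

theorem pathSum_length_lt_le (h : History N) :
    pathSum (fun h' _ _ => if h'.length < N then (1 : ℝ) else 0) h ≤ N := by
  rw [pathSum_ite_length_lt (g := fun _ _ _ => (1 : ℝ)), pathSum_const, mul_one]
  exact_mod_cast List.length_take_le N h

/-- On the event where the score is small and the three kinds of martingales are within their
Hoeffding bounds, no stock is exhausted and the regret is controlled by the slack. -/
theorem Reach.regret_le (hR : 1 ≤ R) (hv : ∀ i, v i ∈ Set.Icc (1 / R) R)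
    (hN : 0 < N) (hK : 0 < K) (hT : 0 < T) (hδ : 0 < δ) (hδ1 : δ < 1) (hB : 1 ≤ M.B)
    (hω : M.omega R δ < 1) {h : History N} (hh : π.Reach h) (hlen : h.length = T)
    (hscore : ∀ i, ∀ t < T, |score v i (h.take t)| ≤ Real.sqrt (offerCount (h.take t) i *
      (3 * Real.log (2 * N * T * (K + 1) / δ)) / 2))
    {d : ℝ} (hd : d = Real.sqrt (T * Real.log (4 * (K + 1) / δ) / 2))
    (huse : ∀ k, pathSum (fun h _ o => 1 * ((M.use k o : ℝ) -
      π.stepMean v h fun _ o => (M.use k o : ℝ))) h ≤ d)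
    (hrev : pathSum (fun h _ o => -1 * (M.rev o - π.stepMean v h fun _ o => M.rev o)) h ≤ d)
    (heps : pathSum (fun h S _ => -1 * (epsSum M R δ h S -
      π.stepMean v h fun S _ => epsSum M R δ h S)) h ≤
        M.B * ((Real.sqrt N + 1) * M.Psi R δ) * d) :
    M.regret v h ≤ (1 + 1 / M.cmin) * M.slack R δ := by
  have hR0 : 0 < R := zero_lt_one.trans_le hR
  have h0 : 0 < 1 / R := by positivity
  have hv0 : ∀ i, 0 < v i := fun i => h0.trans_le (hv i).1
  have hT' : (0 : ℝ) < T := by exact_mod_cast hT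
  have hc := M.cmin_pos hK hT
  have hω0 := M.omega_nonneg (δ := δ) hK hT hR0.le
  have hbudget := M.budget_le_slack hN hK hT hδ hδ1 hR hB
  rw [← hd] at hbudget
  have hsum := hh.pathSum_epsSum_le hR0.le hlen
  have hwarm := pathSum_length_lt_le h
  simp only [stepMean_const_fun π hv0] at heps
  simp only [stepMean, M.sum_choiceProb_mul_use] at huse
  simp only [stepMean, M.sum_choiceProb_mul_rev] at hrev
  have heps' : pathSum (fun h _ _ => π.offerMean h (epsSum M R δ h)) h ≤
      2 * ((Real.sqrt N + 1) * M.Psi R δ) * Real.sqrt (N * (M.B * T)) +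
        M.B * ((Real.sqrt N + 1) * M.Psi R δ) * d := by
    rw [pathSum_const_mul (g := fun h S _ => epsSum M R δ h S - π.offerMean h (epsSum M R δ h)),
      pathSum_sub (g := fun h S _ => epsSum M R δ h S)
        (g' := fun h _ _ => π.offerMean h (epsSum M R δ h))] at heps
    linarith
  have htake : ∀ t < h.length, ∀ i, |score v i (h.take t)| ≤ Real.sqrt (offerCount (h.take t) i *
      (3 * Real.log (2 * N * T * (K + 1) / δ)) / 2) :=
    fun t ht i => hscore i t (hlen ▸ ht)
  have hcap : ∀ k, M.totalUse h k < M.cap k := by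
    intro k
    have hk := huse k
    rw [pathSum_const_mul (g := fun h _ o => (M.use k o : ℝ) - π.offerMean h (M.expUse v k)),
      pathSum_sub (g := fun _ _ o => (M.use k o : ℝ))
        (g' := fun h _ _ => π.offerMean h (M.expUse v k)), ← M.totalUse_eq_pathSum] at hk
    have hmean : pathSum (fun h _ _ => π.offerMean h (M.expUse v k)) h ≤
        pathSum (fun h _ _ => (if h.length < N then 1 else 0) +
          (1 - M.omega R δ) * M.c k + 2 * π.offerMean h (epsSum M R δ h)) h :=
      pathSum_le_of_take fun t ht _ _ =>
        (hh.take t).offerMean_expUse_le hR hv hN hK hT hδ hδ1 hω (htake t ht) k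
    rw [pathSum_add (g := fun h _ _ => (if h.length < N then 1 else 0) +
        (1 - M.omega R δ) * M.c k) (g' := fun h _ _ => 2 * π.offerMean h (epsSum M R δ h)),
      pathSum_add (g := fun h _ _ => if h.length < N then 1 else 0)
        (g' := fun _ _ _ => (1 - M.omega R δ) * M.c k), pathSum_const,
      pathSum_const_mul (g := fun h _ _ => π.offerMean h (epsSum M R δ h)), hlen] at hmean
    have hslack : M.slack R δ ≤ M.omega R δ * (T * M.c k) := by
      rw [← M.omega_mul hK hT, mul_assoc]
      have := M.cmin_le k
      gcongr
    have hTc := M.mul_c hT k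
    have : (M.totalUse h k : ℝ) < M.cap k := by
      rw [← hTc]
      have e : (T : ℝ) * ((1 - M.omega R δ) * M.c k) =
        T * M.c k - M.omega R δ * (T * M.c k) := by ring
      linarith
    exact_mod_cast this
  have hmean : pathSum (fun h _ _ => (1 - M.omega R δ) * M.optLP v -
      (if h.length < N then 1 else 0) - 2 * π.offerMean h (epsSum M R δ h)) h ≤
      pathSum (fun h _ _ => π.offerMean h (M.expRev v)) h :=
    pathSum_le_of_take fun t ht _ _ => (hh.take t).le_offerMean_expRev hR hv hN hK hT hδ hδ1 hω
      (htake t ht) (M.not_aborted_take hcap t)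
  rw [pathSum_sub (g := fun h _ _ => (1 - M.omega R δ) * M.optLP v -
        (if h.length < N then 1 else 0)) (g' := fun h _ _ => 2 * π.offerMean h (epsSum M R δ h)),
    pathSum_sub (g := fun _ _ _ => (1 - M.omega R δ) * M.optLP v)
      (g' := fun h _ _ => if h.length < N then 1 else 0), pathSum_const,
    pathSum_const_mul (g := fun h _ _ => π.offerMean h (epsSum M R δ h)), hlen] at hmean
  rw [pathSum_const_mul (g := fun h _ o => M.rev o - π.offerMean h (M.expRev v)),
    pathSum_sub (g := fun _ _ o => M.rev o) (g' := fun h _ _ => π.offerMean h (M.expRev v)),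
    ← M.totalRev_eq_pathSum] at hrev
  have hωT : M.omega R δ * T = 1 / M.cmin * M.slack R δ := by
    rw [← M.omega_mul hK hT]; field_simp
  have hopt : M.omega R δ * T * M.optLP v ≤ M.omega R δ * T :=
    mul_le_of_le_one_right (by positivity) (M.optLP_le_one hv0 hT)
  rw [hωT] at hopt
  have e : (T : ℝ) * ((1 - M.omega R δ) * M.optLP v) =
    T * M.optLP v - M.omega R δ * T * M.optLP v := by ring
  rw [hωT] at e
  rw [Model.regret, add_mul, one_mul]
  linarith

/-! ### The probability of the good event -/

theorem prob_union_le (π : UCBPolicy M R δ) (hv : ∀ i, 0 < v i) (E F : Set (History N)) :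
    π.prob v hv (E ∪ F) ≤ π.prob v hv E + π.prob v hv F :=
  MeasureTheory.measure_union_le E F

theorem prob_iUnion_le (π : UCBPolicy M R δ) (hv : ∀ i, 0 < v i) {ι : Type*} [Fintype ι]
    (E : ι → Set (History N)) : π.prob v hv (⋃ k, E k) ≤ ∑ k, π.prob v hv (E k) :=
  MeasureTheory.measure_iUnion_fintype_le _ E

/-- The failure probabilities of the `K + 3` concentration events are at most `δ / (4 (K + 1))`
each. -/
theorem prob_regret_le_slack (π : UCBPolicy M R δ) (hv0 : ∀ i, 0 < v i) (hR : 1 ≤ R)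
    (hv : ∀ i, v i ∈ Set.Icc (1 / R) R) (hN : 0 < N) (hK : 0 < K) (hT : 0 < T) (hδ : 0 < δ)
    (hδ1 : δ < 1) (hB : 1 ≤ M.B) (hω : M.omega R δ < 1) :
    ENNReal.ofReal (1 - δ) ≤
      π.prob v hv0 {h | M.regret v h ≤ (1 + 1 / M.cmin) * M.slack R δ} := by
  have hR0 : 0 < R := zero_lt_one.trans_le hR
  set L := Real.log (4 * (K + 1) / δ) with hL
  have hL2 : 2 ≤ L := Model.two_le_log hK hδ hδ1
  set d := Real.sqrt (T * L / 2) with hd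
  set x := 2 * (N : ℝ) * T * (K + 1) / δ with hx
  have hx4 : 4 ≤ x := Model.four_le_arg hN hK hT hδ hδ1
  have hP := M.eight_le_Psi hN hK hT hδ hδ1 hR hB
  set b := M.B * ((Real.sqrt N + 1) * M.Psi R δ) with hb
  have hb0 : 0 < b := by
    have : (0 : ℝ) < M.B := by exact_mod_cast hB
    have : 0 < M.Psi R δ := by linarith
    positivity
  set q := δ / (4 * (K + 1)) with hq
  have hq0 : 0 < q := by positivity
  have hexp : Real.exp (-L) = q := by
    rw [Real.exp_neg, hL, Real.exp_log (by positivity), inv_div]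
  set E0 : Set (History N) := {h | ∃ i, ∃ t < T, Real.sqrt (offerCount (h.take t) i *
    (3 * Real.log x) / 2) < |score v i (h.take t)|} with hE0
  set E1 : Fin K → Set (History N) := fun k => {h | h.length = T ∧ 1 * d ≤ pathSum (fun h S o =>
    1 * ((M.use k o : ℝ) - π.stepMean v h fun _ o => (M.use k o : ℝ))) h} with hE1
  set E2 : Set (History N) := {h | h.length = T ∧ 1 * d ≤ pathSum (fun h S o =>
    -1 * (M.rev o - π.stepMean v h fun _ o => M.rev o)) h} with hE2
  set E3 : Set (History N) := {h | h.length = T ∧ b * d ≤ pathSum (fun h S o =>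
    -1 * (epsSum M R δ h S - π.stepMean v h fun S _ => epsSum M R δ h S)) h} with hE3
  set G : Set (History N) := {h | M.regret v h ≤ (1 + 1 / M.cmin) * M.slack R δ} with hG
  have p0 : π.prob v hv0 E0 ≤ ENNReal.ofReal q := by
    refine (π.prob_exists_score_le hv0 (a := 3 * Real.log x)
      (by have := Real.log_nonneg (show 1 ≤ x by linarith); positivity)).trans
      (ENNReal.ofReal_le_ofReal ?_)
    have e : Real.exp (-(3 * Real.log x)) = 1 / x ^ 3 := by
      rw [Real.exp_neg, show 3 * Real.log x = (3 : ℕ) * Real.log x by norm_num,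
        Real.exp_nat_mul, Real.exp_log (by linarith), one_div]
    have hx0 : 0 < x := by linarith
    have hN' : (1 : ℝ) ≤ N := by exact_mod_cast hN
    have hT' : (1 : ℝ) ≤ T := by exact_mod_cast hT
    have hK' : (1 : ℝ) ≤ K := by exact_mod_cast hK
    have hxd : x * δ = 2 * N * T * (K + 1) := by rw [hx]; field_simp
    have hTx : (T : ℝ) ≤ x := by
      rw [hx, le_div_iff₀ hδ]
      nlinarith [mul_le_mul hN' hK' zero_le_one (by linarith)]
    rw [e, mul_one_div, hq, div_le_div_iff₀ (by positivity) (by positivity)]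
    calc 2 * (N : ℝ) * T * T * (4 * (K + 1)) = 4 * T * (2 * N * T * (K + 1)) := by ring
      _ = 4 * T * (x * δ) := by rw [hxd]
      _ ≤ x * x * (x * δ) := by gcongr
      _ = δ * x ^ 3 := by ring
  have p1 : ∀ k, π.prob v hv0 (E1 k) ≤ ENNReal.ofReal q := fun k => by
    rw [← hexp]
    exact π.prob_azuma hv0 (f := fun _ _ o => (M.use k o : ℝ)) one_pos
      (fun _ _ _ o => M.use_mem_Icc k o) (Or.inl rfl) (by linarith) hT
  have p2 : π.prob v hv0 E2 ≤ ENNReal.ofReal q := by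
    rw [← hexp]
    exact π.prob_azuma hv0 (f := fun _ _ o => M.rev o) one_pos
      (fun _ _ _ o => M.rev_mem_Icc o) (Or.inr rfl) (by linarith) hT
  have p3 : π.prob v hv0 E3 ≤ ENNReal.ofReal q := by
    rw [← hexp]
    exact π.prob_azuma hv0 (f := fun h S _ => epsSum M R δ h S) hb0
      (fun h S hS _ => ⟨epsSum_nonneg hR0.le h S,
        epsSum_le hR0.le h (mem_family_of_offerLaw_ne_zero hS)⟩) (Or.inr rfl) (by linarith) hT
  have hone : π.prob v hv0 (G ∪ (E0 ∪ ((⋃ k, E1 k) ∪ (E2 ∪ E3)))) = 1 := by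
    refine prob_eq_one_of_forall hv0 fun h hh hlen => ?_
    by_contra hnot
    simp only [Set.mem_union, Set.mem_iUnion, not_or, not_exists] at hnot
    obtain ⟨n1, n2, n3, n4, n5⟩ := hnot
    refine n1 (hh.regret_le hR hv hN hK hT hδ hδ1 hB hω hlen (fun i t ht => ?_) hd
      (fun k => ?_) ?_ ?_)
    · exact not_lt.mp fun hlt => n2 ⟨i, t, ht, hlt⟩
    · have := not_le.mp fun hle => n3 k ⟨hlen, hle⟩
      linarith
    · have := not_le.mp fun hle => n4 ⟨hlen, hle⟩
      linarith
    · exact (not_le.mp fun hle => n5 ⟨hlen, hle⟩).le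
  have hall : π.prob v hv0 (G ∪ (E0 ∪ ((⋃ k, E1 k) ∪ (E2 ∪ E3)))) ≤
      π.prob v hv0 G + ENNReal.ofReal δ := by
    refine (π.prob_union_le hv0 _ _).trans ?_
    gcongr
    calc _ ≤ π.prob v hv0 E0 + (π.prob v hv0 (⋃ k, E1 k) +
          (π.prob v hv0 E2 + π.prob v hv0 E3)) := by
          refine (π.prob_union_le hv0 _ _).trans ?_
          gcongr
          refine (π.prob_union_le hv0 _ _).trans ?_
          gcongr
          exact π.prob_union_le hv0 _ _
      _ ≤ ENNReal.ofReal q + (∑ k : Fin K, ENNReal.ofReal q +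
          (ENNReal.ofReal q + ENNReal.ofReal q)) := by
          gcongr
          exact (π.prob_iUnion_le hv0 E1).trans (Finset.sum_le_sum fun k _ => p1 k)
      _ = ENNReal.ofReal ((K + 3) * q) := by
          rw [Finset.sum_const, ← ENNReal.ofReal_nsmul, ← ENNReal.ofReal_add hq0.le hq0.le,
            ← ENNReal.ofReal_add (by positivity) (by positivity),
            ← ENNReal.ofReal_add hq0.le (by positivity)]
          congr 1
          simp
          ring
      _ ≤ ENNReal.ofReal δ := by
          refine ENNReal.ofReal_le_ofReal ?_
          have hK' : (1 : ℝ) ≤ K := by exact_mod_cast hK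
          rw [hq, mul_div_assoc', div_le_iff₀ (by positivity), mul_comm]
          gcongr
          linarith
  rw [hone] at hall
  rw [ENNReal.ofReal_sub _ hδ.le, ENNReal.ofReal_one]
  exact tsub_le_iff_right.mpr hall

end UCBPolicy

/-! ### The order of the bound -/

/-- The slack has the order of the claimed bound. The assumption excludes only the case
`T = N = K = 1`, in which `log (T N K / δ)` may be close to `0`. -/
theorem Model.slack_le {N K T : ℕ} (M : Model N K T) {R δ : ℝ} (hN : 0 < N) (hK : 0 < K)
    (hT : 0 < T) (hδ : 0 < δ) (hδ1 : δ < 1) (hR : 1 ≤ R) (hB : 1 ≤ M.B)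
    (h2 : 2 ≤ T * N * K) :
    M.slack R δ ≤ 400 * (Real.sqrt T * R ^ 3 * (M.B : ℝ) ^ (5 / 2 : ℝ) * N *
      Real.log (T * N * K / δ)) := by
  have hN' : (1 : ℝ) ≤ N := by exact_mod_cast hN
  have hT' : (1 : ℝ) ≤ T := by exact_mod_cast hT
  have hK' : (1 : ℝ) ≤ K := by exact_mod_cast hK
  have hB' : (1 : ℝ) ≤ M.B := by exact_mod_cast hB
  have h2' : (2 : ℝ) ≤ T * N * K := by exact_mod_cast h2
  set z := (T : ℝ) * N * K / δ with hz
  have hz2 : 2 ≤ z := by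
    rw [hz, le_div_iff₀ hδ]; nlinarith
  set y := Real.log z with hy
  have hy0 : 0 < y := Real.log_pos (by linarith)
  have hzd : z * δ = T * N * K := by rw [hz]; field_simp
  have hz4 : 4 * z ≤ z ^ 3 := by
    have h1 : 4 ≤ z ^ 2 := by
      calc (4 : ℝ) = 2 ^ 2 := by norm_num
        _ ≤ z ^ 2 := by gcongr
    nlinarith
  have hz8 : 8 * z ≤ z ^ 4 := by
    have h1 : 8 ≤ z ^ 3 := by
      calc (8 : ℝ) = 2 ^ 3 := by norm_num
        _ ≤ z ^ 3 := by gcongr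
    nlinarith
  have hTN : 1 ≤ (T : ℝ) * N := one_le_mul_of_one_le_of_one_le hT' hN'
  have hl1 : Real.log (2 * N * T * (K + 1) / δ) ≤ 3 * y := by
    rw [hy, show 3 * Real.log z = (3 : ℕ) * Real.log z by norm_num, ← Real.log_pow]
    refine Real.log_le_log (by positivity) (le_trans ?_ hz4)
    rw [div_le_iff₀ hδ, mul_assoc 4, hzd]
    nlinarith
  have hl2 : Real.log (4 * (K + 1) / δ) ≤ 4 * y := by
    rw [hy, show 4 * Real.log z = (4 : ℕ) * Real.log z by norm_num, ← Real.log_pow]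
    refine Real.log_le_log (by positivity) (le_trans ?_ hz8)
    rw [div_le_iff₀ hδ, mul_assoc 8, hzd]
    nlinarith
  have hRB : (1 + M.B * R) ^ 2 ≤ 4 * (M.B : ℝ) ^ 2 * R ^ 2 := by
    have h1 : 1 ≤ (M.B : ℝ) * R := one_le_mul_of_one_le_of_one_le hB' hR
    nlinarith
  have hpow : (M.B : ℝ) ^ (5 / 2 : ℝ) = (M.B : ℝ) ^ 2 * Real.sqrt M.B := by
    rw [show (5 / 2 : ℝ) = (2 : ℕ) + 1 / 2 by norm_num, Real.rpow_add (by linarith),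
      Real.rpow_natCast, Real.sqrt_eq_rpow]
  have hs1 : Real.sqrt (6 * Real.log (2 * N * T * (K + 1) / δ)) ≤ Real.sqrt 18 * Real.sqrt y := by
    rw [← Real.sqrt_mul (by norm_num)]
    exact Real.sqrt_le_sqrt (by linarith)
  have hs2 : Real.sqrt (M.B * T * Real.log (4 * (K + 1) / δ)) ≤
      Real.sqrt M.B * Real.sqrt T * (2 * Real.sqrt y) := by
    rw [Real.sqrt_mul (by positivity), Real.sqrt_mul (by positivity)]
    gcongr
    calc Real.sqrt (Real.log (4 * (K + 1) / δ)) ≤ Real.sqrt (2 ^ 2 * y) :=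
          Real.sqrt_le_sqrt (by linarith)
      _ = 2 * Real.sqrt y := by rw [Real.sqrt_mul (by norm_num), Real.sqrt_sq (by norm_num)]
  have h18 : Real.sqrt 18 ≤ 4.5 := Real.sqrt_le_iff.mpr ⟨by norm_num, by norm_num⟩
  have hR0 : 0 < R := by linarith
  rw [Model.slack, Model.Psi, hpow]
  calc 11 * (R * (1 + M.B * R) ^ 2 * Real.sqrt (6 * Real.log (2 * N * T * (K + 1) / δ))) * N *
        Real.sqrt (M.B * T * Real.log (4 * (K + 1) / δ))
      ≤ 11 * (R * (4 * (M.B : ℝ) ^ 2 * R ^ 2) * (4.5 * Real.sqrt y)) * N *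
        (Real.sqrt M.B * Real.sqrt T * (2 * Real.sqrt y)) := by
        gcongr
        exact hs1.trans (by gcongr)
    _ = 396 * (Real.sqrt T * R ^ 3 * ((M.B : ℝ) ^ 2 * Real.sqrt M.B) * N *
        (Real.sqrt y * Real.sqrt y)) := by ring
    _ = 396 * (Real.sqrt T * R ^ 3 * ((M.B : ℝ) ^ 2 * Real.sqrt M.B) * N * y) := by
        rw [Real.mul_self_sqrt hy0.le]
    _ ≤ _ := by gcongr; norm_num

/-! ### A single period with a single product -/

/-- With one product and one period, the warm start is the whole horizon. -/
theorem UCBPolicy.le_prob_sale {M : Model 1 1 1} {R δ : ℝ} (π : UCBPolicy M R δ)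
    {v : Fin 1 → ℝ} (hv : ∀ i, 0 < v i) {E : Set (History 1)}
    (hE : [(π.warm 0, some 0)] ∈ E) :
    ENNReal.ofReal (choiceProb v (π.warm 0) (some 0)) ≤ π.prob v hv E := by
  let _ : MeasurableSpace (History 1) := ⊤
  rw [UCBPolicy.prob, PMF.toMeasure_apply _ MeasurableSet.of_discrete]
  refine le_trans ?_ (ENNReal.le_tsum [(π.warm 0, some 0)])
  rw [Set.indicator_of_mem hE]
  simp only [UCBPolicy.historyLaw, PMF.pure_bind]
  rw [UCBPolicy.offerLaw_of_lt (by simp), PMF.pure_bind, PMF.bind_apply]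
  refine le_trans (le_of_eq ?_) (ENNReal.le_tsum (some 0))
  simp [choiceLaw, PMF.ofFintype_apply]

/-- With one product, one resource and one period, `log (T N K / δ)` can be arbitrarily small. The
bound then holds since either it exceeds the optimal value or the probability of a sale, after which
the regret is not positive, exceeds `1 - δ`. -/
theorem UCBPolicy.prob_regret_le_of_one {M : Model 1 1 1} {R δ : ℝ} (π : UCBPolicy M R δ)
    {v : Fin 1 → ℝ} (hv : ∀ i, 0 < v i) (hδ : 0 < δ) {u : ℝ} (hu : 1 - δ ≤ u) (hu0 : 0 ≤ u) :
    ENNReal.ofReal (1 - δ) ≤ π.prob v hv {h | M.regret v h ≤ u} := by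
  have hwarm : π.warm 0 = {0} := by
    ext i
    have := π.mem_warm 0
    rw [Subsingleton.elim i 0]
    simp [this]
  set p := choiceProb v {0} (some 0) with hp
  have hp0 : 0 ≤ p := choiceProb_nonneg hv _ _
  have hrev : ∀ S, M.expRev v S ≤ M.r 0 * p := by
    intro S
    by_cases hS : (0 : Fin 1) ∈ S
    · have : S = {0} := by
        ext i
        rw [Subsingleton.elim i 0]
        simp [hS]
      subst this
      simp [Model.expRev, hp]
    · have : S = ∅ := Finset.eq_empty_of_forall_notMem fun i => by
        rwa [Subsingleton.elim i 0]
      subst this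
      simpa [Model.expRev] using mul_nonneg (M.r_nonneg 0) hp0
  have hopt : M.optLP v ≤ M.r 0 * p := by
    refine M.optLP_le one_pos fun y hy => ?_
    calc ∑ S ∈ M.family, M.expRev v S * y S ≤ ∑ S ∈ M.family, M.r 0 * p * y S :=
          Finset.sum_le_sum fun S hS => mul_le_mul_of_nonneg_right (hrev S) (hy.2.2 S hS)
      _ = M.r 0 * p := by rw [← Finset.mul_sum, hy.2.1, mul_one]
  have hr0 := M.r_nonneg 0
  have hr1 := M.r_le_one 0
  rcases le_total p u with hpu | hup
  · rw [UCBPolicy.prob_eq_one_of_forall hv fun h _ _ => ?_]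
    · rw [ENNReal.ofReal_le_one]; linarith
    · have h1 : 0 ≤ M.totalRev h :=
        List.sum_nonneg fun x hx => by
          obtain ⟨e, -, rfl⟩ := List.mem_map.mp hx
          exact (M.rev_mem_Icc _).1
      have h2 : M.r 0 * p ≤ p := mul_le_of_le_one_left hp0 hr1
      rw [Set.mem_ofPred_eq, Model.regret, Nat.cast_one, one_mul]
      linarith
  · refine (ENNReal.ofReal_le_ofReal (hu.trans hup)).trans ?_
    rw [hp, ← hwarm]
    refine π.le_prob_sale hv ?_
    have hp1 : p ≤ 1 := by
      rw [hp, ← sum_choiceProb hv {0}]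
      exact Finset.single_le_sum (f := choiceProb v {0})
        (fun o _ => choiceProb_nonneg hv _ o) (Finset.mem_univ _)
    have h2 : M.r 0 * p ≤ M.r 0 := mul_le_of_le_one_right hr0 hp1
    rw [Set.mem_ofPred_eq, Model.regret, Nat.cast_one, one_mul]
    simp only [Model.totalRev, List.map_cons, List.map_nil, List.sum_cons, List.sum_nil, add_zero,
      Model.rev]
    linarith

end Assortment

theorem theorem6 :
    ∃ C : ℝ, 0 < C ∧
      ∀ (N K T : ℕ) (M : Assortment.Model N K T) (R δ : ℝ) (v : Fin N → ℝ)
        (hv : ∀ i, 0 < v i),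
        0 < N → 0 < K → 0 < T → 0 < δ → δ < 1 →
        (∀ i, v i ∈ Set.Icc (1 / R) R) →
        (∀ i, ∃ S ∈ M.family, i ∈ S) →
        M.omega R δ < 1 →
        Nonempty (Assortment.UCBPolicy M R δ) ∧
        ∀ π : Assortment.UCBPolicy M R δ,
          π.prob v hv {h | ∀ k, (M.totalUse h k : ℝ) ≤ T * M.c k} = 1 ∧
          ENNReal.ofReal (1 - δ) ≤
            π.prob v hv {h | M.regret v h ≤
              C * (1 + 1 / M.cmin) *
                (Real.sqrt T * R ^ 3 * (M.B : ℝ) ^ (5 / 2 : ℝ) * N *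
                  Real.log (T * N * K / δ))} := by
  refine ⟨400, by norm_num, fun N K T M R δ v hv hN hK hT hδ hδ1 hvR hcov hω => ?_⟩
  have hR : 1 ≤ R := by
    have h1 := hvR ⟨0, hN⟩
    have hR0 : 0 < R := (hv ⟨0, hN⟩).trans_le h1.2
    have h2 := h1.1.trans h1.2
    rw [div_le_iff₀ hR0] at h2
    nlinarith
  have hB := M.one_le_B hN hcov
  have hc := M.cmin_pos hK hT
  refine ⟨M.nonempty_ucbPolicy hT hR hω hcov, fun π => ⟨?_, ?_⟩⟩
  · refine Assortment.UCBPolicy.prob_eq_one_of_forall hv fun h hh _ k => ?_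
    rw [M.mul_c hT]
    exact_mod_cast hh.totalUse_le_cap (M.N_lt_cap hN hK hT hδ hδ1 hR hB hω k)
  by_cases h2 : 2 ≤ T * N * K
  · refine (π.prob_regret_le_slack hv hR hvR hN hK hT hδ hδ1 hB hω).trans
      (MeasureTheory.measure_mono fun h hh => ?_)
    rw [Set.mem_ofPred_eq] at hh ⊢
    refine hh.trans ?_
    rw [mul_comm (400 : ℝ), mul_assoc]
    exact mul_le_mul_of_nonneg_left (M.slack_le hN hK hT hδ hδ1 hR hB h2) (by positivity)
  · have h1 : T * N * K = 1 := by
      have : 0 < T * N * K := by positivity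
      omega
    obtain ⟨h3, rfl⟩ := mul_eq_one.mp h1
    obtain ⟨rfl, rfl⟩ := mul_eq_one.mp h3
    have hlog : 1 - δ ≤ Real.log (1 / δ) := by
      rw [one_div, Real.log_inv]
      linarith [Real.log_le_sub_one_of_pos hδ]
    have hR3 : 1 ≤ R ^ 3 := one_le_pow₀ hR
    have hB5 : 1 ≤ (M.B : ℝ) ^ (5 / 2 : ℝ) :=
      Real.one_le_rpow (by exact_mod_cast hB) (by norm_num)
    have hcm : 1 ≤ 1 + 1 / M.cmin := by
      have : 0 < 1 / M.cmin := by positivity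
      linarith
    have hlog0 : 0 ≤ Real.log (1 / δ) := by linarith
    have hbound : Real.log (1 / δ) ≤ 400 * (1 + 1 / M.cmin) * (Real.sqrt (1 : ℕ) * R ^ 3 *
        (M.B : ℝ) ^ (5 / 2 : ℝ) * (1 : ℕ) * Real.log ((1 : ℕ) * (1 : ℕ) * (1 : ℕ) / δ)) := by
      simp only [Nat.cast_one, Real.sqrt_one, one_mul, mul_one]
      calc Real.log (1 / δ) = 1 * 1 * (1 * 1 * Real.log (1 / δ)) := by ring
        _ ≤ _ := by gcongr; norm_num
    exact π.prob_regret_le_of_one hv hδ (hlog.trans hbound) (hlog0.trans hbound)
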